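/- **Setting.** For integers $k\ge 1$ and $n\ne 0$ let $G_{k,n}=\langle a,b\mid w^n a=b w^n\rangle$ be the knot group of the double twist knot $J(k,2n)$, where $w=(ba^{-1})^m(b^{-1}a)^m$ if $k=2m$ and $w=(ba^{-1})^m\,ba\,(b^{-1}a)^m$ if $k=2m+1$. The generators $a,b$ are meridians, and the abelianization $\mathfrak a:G_{k,n}\to\langle t\rangle\cong\mathbb Z$ sends both to $t$. Put $r=w^n a w^{-n} b^{-1}$. For a representation $\rho:G_{k,n}\to \mathrm{SL}_2(\mathbb C)$ let $\mathrm{Ad}(V)(g)=VgV^{-1}$ be the adjoint action of $\mathrm{SL}_2(\mathbb C)$ on $\mathfrak{sl}_2(\mathbb C)\cong\mathbb C^3$, and let $\Phi:\mathbb Z[F(a,b)]\to M_3(\mathbb C[t^{\pm1}])$ be the ring homomorphism with $\Phi(g)=\mathfrak a(g)\,\mathrm{Ad}(\rho(g))$ for $g\in F(a,b)$. The adjoint twisted Alexander polynomial is the rational function $$\Delta^{\mathrm{Ad}\circ\rho}_{J(k,2n)}(t)=\frac{\det\Phi\left(\partial r/\partial a\right)}{\det\Phi(1-b)}\in\mathbb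 C(t),$$ where $\partial/\partial a$ is the Fox derivative. Put $y=\operatorname{tr}\rho(ab^{-1})$ and $z=\operatorname{tr}\rho(w)$, and let $S_l$ ($l\in\mathbb Z$) be the Chebyshev polynomials with $S_0(v)=1$, $S_1(v)=v$, $S_l(v)=vS_{l-1}(v)-S_{l-2}(v)$. **Proposition 3.6.** Let $n\ge 1$, and let $\rho_0:G_{k,n}\to\mathrm{SL}_2(\mathbb C)$ be a holonomy representation of $J(k,2n)$, i.e. a lift of a discrete and faithful representation $G_{k,n}\to\mathrm{PSL}_2(\mathbb C)$; or, more generally (so that the non-hyperbolic knots are covered too), let $\rho_0$ be either such a lift or a representation with nonabelian image and $\operatorname{tr}\rho_0(a)=\pm2$. Then in each of the following cases $\Delta^{\mathrm{Ad}\circ\rho_0}_{J(k,2n)}(t)$ is a Laurent polynomial, whose highest and lowest degree terms (with nonzero coefficients) are the two terms displayed: 1. if $k=2m$ with $m\ge1$, $$\Delta^{\mathrm{Ad}\circ\rho_0}_{J(k,2n)}(t)=-mn\,S_{m-1}(y)^2S_{n-1}(z)^2\,t^0+\cdots+mn\,S_{m-1}(y)^2S_{n-1}(z)^2\,t^{-3};$$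 2. if $k=2m+1\ge3$, $$\Delta^{\mathrm{Ad}\circ\rho_0}_{J(k,2n)}(t)=m\,S_{m-1}(y)^2\,t^{6n-3}+\cdots-m\,S_{m-1}(y)^2\,t^{0};$$ 3. if $k=1$ and $n\ge2$, $$\Delta^{\mathrm{Ad}\circ\rho_0}_{J(k,2n)}(t)=-t^{6n-6}+\cdots+t^{3}.$$ -/

import Mathlib

open scoped LaurentPolynomial MatrixGroups

noncomputable section

namespace DoubleTwist

/-! ### Fox calculus on a free group -/

/-- The integral group ring of the free group on `α`. -/
abbrev FreeRing (α : Type) : Type := MonoidAlgebra ℤ (FreeGroup α)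

/-- The Fox derivative with respect to the generator `j`, computed on a word in the letters
`x_i` (the pair `(i, true)`) and `x_i⁻¹` (the pair `(i, false)`). -/
def foxWord {α : Type} [DecidableEq α] (j : α) : List (α × Bool) → FreeRing α
  | [] => 0
  | (i, true) :: L =>
      (if i = j then 1 else 0) + MonoidAlgebra.of ℤ _ (FreeGroup.of i) * foxWord j L
  | (i, false) :: L =>
      MonoidAlgebra.of ℤ _ (FreeGroup.of i)⁻¹ * (foxWord j L - if i = j then 1 else 0)

/-- The Fox derivative `∂g/∂x_j` of an element `g` of the free group. -/
def fox {α : Type} [DecidableEq α] (j : α) (g : FreeGroup α) : FreeRing α :=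
  foxWord j g.toWord

theorem foxWord_append {α : Type} [DecidableEq α] (j : α) (L M : List (α × Bool)) :
    foxWord j (L ++ M) =
      foxWord j L + MonoidAlgebra.of ℤ _ (FreeGroup.mk L) * foxWord j M := by
  induction L with
  | nil =>
    rw [List.nil_append, ← FreeGroup.one_eq_mk, map_one]
    simp [foxWord]
  | cons p L ih =>
    obtain ⟨i, s⟩ := p
    have h : (FreeGroup.mk ((i, s) :: L) : FreeGroup α)
        = FreeGroup.mk [(i, s)] * FreeGroup.mk L := by
      rw [FreeGroup.mul_mk]; rfl
    cases s with
    | true =>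
      have h1 : (FreeGroup.mk [(i, true)] : FreeGroup α) = FreeGroup.of i := rfl
      rw [h, h1, map_mul, List.cons_append]
      simp only [foxWord, ih, mul_add, mul_assoc, add_assoc]
    | false =>
      have h1 : (FreeGroup.mk [(i, false)] : FreeGroup α) = (FreeGroup.of i)⁻¹ := rfl
      rw [h, h1, map_mul, List.cons_append]
      simp only [foxWord, ih, mul_add, mul_sub, mul_assoc]
      abel

theorem foxWord_step {α : Type} [DecidableEq α] (j : α) {L M : List (α × Bool)}
    (h : FreeGroup.Red.Step L M) : foxWord j L = foxWord j M := by
  cases h with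
  | @not L₁ L₂ x b =>
    rw [foxWord_append, foxWord_append]
    congr 2
    cases b <;>
      simp only [foxWord, Bool.not_true, Bool.not_false, mul_sub, mul_add, ← mul_assoc,
        ← map_mul, inv_mul_cancel, mul_inv_cancel, map_one, one_mul] <;> abel

theorem foxWord_red {α : Type} [DecidableEq α] (j : α) {L M : List (α × Bool)}
    (h : FreeGroup.Red L M) : foxWord j L = foxWord j M := by
  induction h with
  | refl => rfl
  | tail _ h ih => exact ih.trans (foxWord_step j h)

/-- The product rule `∂(gh)/∂x_j = ∂g/∂x_j + g ∂h/∂x_j`. -/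
theorem fox_mul {α : Type} [DecidableEq α] (j : α) (g h : FreeGroup α) :
    fox j (g * h) = fox j g + MonoidAlgebra.of ℤ _ g * fox j h := by
  have hg : FreeGroup.mk g.toWord = g := FreeGroup.mk_toWord
  have : (g * h).toWord = FreeGroup.reduce (g.toWord ++ h.toWord) := FreeGroup.toWord_mul g h
  unfold fox
  rw [this, ← foxWord_red j FreeGroup.reduce.red, foxWord_append, hg]

/-- The rule `∂x_i/∂x_j = δ_{ij}`. -/
theorem fox_of {α : Type} [DecidableEq α] (i j : α) :
    fox j (FreeGroup.of i) = if i = j then 1 else 0 := by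
  simp [fox, foxWord]

/-! ### The group of a double twist knot -/

/-- The free group on the two meridian generators `a` and `b`. -/
abbrev F2 : Type := FreeGroup (Fin 2)

/-- The free generator `a`. -/
def fa : F2 := FreeGroup.of 0

/-- The free generator `b`. -/
def fb : F2 := FreeGroup.of 1

/-- The word `w`: it is `(ba⁻¹)^m (b⁻¹a)^m` if `k = 2m`, and `(ba⁻¹)^m ba (b⁻¹a)^m` if
`k = 2m + 1`. -/
def word (k : ℕ) : F2 :=
  (fb * fa⁻¹) ^ (k / 2) * (if Even k then 1 else fb * fa) * (fb⁻¹ * fa) ^ (k / 2)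

/-- The relator `r = wⁿ a w⁻ⁿ b⁻¹`. -/
def relator (k : ℕ) (n : ℤ) : F2 :=
  word k ^ n * fa * word k ^ (-n) * fb⁻¹

/-- The knot group of `J(k, 2n)`, in the presentation `⟨a, b | wⁿ a = b wⁿ⟩`. -/
abbrev KnotGroup (k : ℕ) (n : ℤ) : Type := PresentedGroup {relator k n}

/-- The projection of the free group onto the knot group. -/
def proj (k : ℕ) (n : ℤ) : F2 →* KnotGroup k n := PresentedGroup.mk {relator k n}

/-- The abelianization `G(K) → ℤ = ⟨t⟩`, which sends both meridians `a`, `b` to `t`. -/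
def abel (k : ℕ) (n : ℤ) : KnotGroup k n →* Multiplicative ℤ :=
  PresentedGroup.toGroup (f := fun _ => Multiplicative.ofAdd 1) (by
    intro r hr
    rw [Set.mem_singleton_iff.1 hr]
    simp [relator, fa, fb])

/-! ### The adjoint representation of `SL₂(ℂ)` -/

/-- The Lie algebra `sl₂(ℂ)` of traceless matrices. -/
abbrev sl2 : Type := LieAlgebra.SpecialLinear.sl (Fin 2) ℂ

theorem sl2_trace (X : sl2) : Matrix.trace X.1 = 0 :=
  LinearMap.mem_ker.1 X.2

theorem mem_sl2 {X : Matrix (Fin 2) (Fin 2) ℂ} (h : Matrix.trace X = 0) :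
    X ∈ LieAlgebra.SpecialLinear.sl (Fin 2) ℂ :=
  LinearMap.mem_ker.2 h

/-- The adjoint action `Ad(V)(g) = V g V⁻¹` of `SL₂(ℂ)` on `sl₂(ℂ)`. -/
def adjointAction : SL(2, ℂ) →* Module.End ℂ sl2 where
  toFun V :=
    { toFun := fun X => ⟨V.1 * X.1 * (V⁻¹).1, mem_sl2 (by
        rw [Matrix.trace_mul_comm, ← mul_assoc, ← Matrix.SpecialLinearGroup.coe_mul,
          inv_mul_cancel, Matrix.SpecialLinearGroup.coe_one, one_mul, sl2_trace])⟩
      map_add' := fun X Y => Subtype.ext (by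
        change V.1 * (X.1 + Y.1) * (V⁻¹).1 = V.1 * X.1 * (V⁻¹).1 + V.1 * Y.1 * (V⁻¹).1
        rw [mul_add, add_mul])
      map_smul' := fun c X => Subtype.ext (by
        change V.1 * (c • X.1) * (V⁻¹).1 = c • (V.1 * X.1 * (V⁻¹).1)
        rw [Matrix.mul_smul, Matrix.smul_mul]) }
  map_one' := by
    ext1 X
    apply Subtype.ext
    change (1 : SL(2, ℂ)).1 * X.1 * ((1 : SL(2, ℂ))⁻¹).1 = X.1
    rw [inv_one, Matrix.SpecialLinearGroup.coe_one, one_mul, mul_one]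
  map_mul' V W := by
    ext1 X
    apply Subtype.ext
    change (V * W).1 * X.1 * ((V * W)⁻¹).1 = V.1 * (W.1 * X.1 * (W⁻¹).1) * (V⁻¹).1
    rw [mul_inv_rev, Matrix.SpecialLinearGroup.coe_mul, Matrix.SpecialLinearGroup.coe_mul]
    simp only [mul_assoc]

/-- Coordinates on `sl₂(ℂ)`: the triple `(p, q, r)` corresponds to the matrix
`[[q, p], [r, -q]]`. -/
def sl2Equiv : sl2 ≃ₗ[ℂ] (Fin 3 → ℂ) where
  toFun X := ![X.1 0 1, X.1 0 0, X.1 1 0]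
  map_add' X Y := by
    ext i; fin_cases i <;> rfl
  map_smul' c X := by
    ext i; fin_cases i <;> rfl
  invFun v := ⟨!![v 1, v 0; v 2, - v 1], mem_sl2 (by simp [Matrix.trace_fin_two])⟩
  left_inv X := by
    have h := sl2_trace X
    rw [Matrix.trace_fin_two] at h
    apply Subtype.ext
    ext i j
    fin_cases i <;> fin_cases j
    · rfl
    · rfl
    · rfl
    · exact neg_eq_of_add_eq_zero_right h
  right_inv v := by
    ext i; fin_cases i <;> rfl

/-- The standard basis `E, H, F` of `sl₂(ℂ)`. -/
def sl2Basis : Module.Basis (Fin 3) ℂ sl2 := Module.Basis.ofEquivFun sl2Equiv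

/-- `Ad(V)` as a `3 × 3` matrix. -/
def Ad : SL(2, ℂ) →* Matrix (Fin 3) (Fin 3) ℂ :=
  (LinearMap.toMatrixAlgEquiv sl2Basis :
    Module.End ℂ sl2 ≃* Matrix (Fin 3) (Fin 3) ℂ).toMonoidHom.comp adjointAction

/-! ### The adjoint twisted Alexander polynomial -/

/-- `(Ad ∘ ρ) ⊗ 𝔞` on group elements: `g ↦ t^{𝔞(g)} Ad(ρ(g))`. -/
def tensorRep {k : ℕ} {n : ℤ} (ρ : KnotGroup k n →* SL(2, ℂ)) :
    KnotGroup k n →* Matrix (Fin 3) (Fin 3) ℂ[T;T⁻¹] where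
  toFun g := LaurentPolynomial.T (Multiplicative.toAdd (abel k n g)) •
    (Ad (ρ g)).map (LaurentPolynomial.C : ℂ →+* ℂ[T;T⁻¹])
  map_one' := by
    rw [map_one (abel k n), map_one ρ, map_one Ad, toAdd_one, LaurentPolynomial.T_zero (R := ℂ), one_smul,
      Matrix.map_one LaurentPolynomial.C (map_zero LaurentPolynomial.C) (map_one LaurentPolynomial.C)]
  map_mul' g h := by
    rw [map_mul (abel k n), map_mul ρ, map_mul Ad, toAdd_mul, LaurentPolynomial.T_add, Matrix.map_mul,
      Matrix.smul_mul, Matrix.mul_smul, smul_smul]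

/-- The ring homomorphism `Φ : ℤ[F₂] → M₃(ℂ[t, t⁻¹])`. -/
def Phi {k : ℕ} {n : ℤ} (ρ : KnotGroup k n →* SL(2, ℂ)) :
    FreeRing (Fin 2) →ₐ[ℤ] Matrix (Fin 3) (Fin 3) ℂ[T;T⁻¹] :=
  MonoidAlgebra.lift ℤ _ _ ((tensorRep ρ).comp (proj k n))

/-- The field `ℂ(t)` of rational functions, as the fraction field of `ℂ[t, t⁻¹]`. -/
abbrev RatField : Type := FractionRing ℂ[T;T⁻¹]

/-- The adjoint twisted Alexander polynomial
`Δ^{Ad ∘ ρ}(t) = det Φ(∂r/∂a) / det Φ(1 - b)`, a rational function of `t`. -/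
def adjointAlexander {k : ℕ} {n : ℤ} (ρ : KnotGroup k n →* SL(2, ℂ)) : RatField :=
  algebraMap ℂ[T;T⁻¹] RatField (Phi ρ (fox 0 (relator k n))).det /
    algebraMap ℂ[T;T⁻¹] RatField (Phi ρ (1 - MonoidAlgebra.of ℤ _ fb)).det

/-- The rational function `f` is a Laurent polynomial, with highest degree term `c t^d` and
lowest degree term `c' t^e` (so the coefficients `c` and `c'` are not zero). -/
def HasExtremeTerms (f : RatField) (d : ℤ) (c : ℂ) (e : ℤ) (c' : ℂ) : Prop :=
  ∃ P : ℂ[T;T⁻¹], f = algebraMap ℂ[T;T⁻¹] RatField P ∧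
    (P.coeff d = c ∧ c ≠ 0 ∧ ∀ i, d < i → P.coeff i = 0) ∧
    (P.coeff e = c' ∧ c' ≠ 0 ∧ ∀ i, i < e → P.coeff i = 0)

/-! ### Representations -/

/-- The representation is nonabelian: its image is a nonabelian group. -/
def IsNonabelian {G : Type} [Group G] (ρ : G →* SL(2, ℂ)) : Prop :=
  ∃ g h : G, ρ g * ρ h ≠ ρ h * ρ g

/-- The projection of `SL₂(ℂ)` onto `PSL₂(ℂ) = Isom⁺(ℍ³)`. -/
def toPSL : SL(2, ℂ) →* Matrix.ProjectiveSpecialLinearGroup (Fin 2) ℂ :=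
  QuotientGroup.mk' (Subgroup.center SL(2, ℂ))

/-- `ρ` is a lift to `SL₂(ℂ)` of a discrete and faithful representation into `PSL₂(ℂ)`, that is,
a lift of the holonomy representation of a hyperbolic knot. -/
def IsHolonomyLift {G : Type} [Group G] (ρ : G →* SL(2, ℂ)) : Prop :=
  Function.Injective (toPSL.comp ρ) ∧ DiscreteTopology (toPSL.comp ρ).range

/-- `ρ` is nonabelian and the trace of the meridian `a` is `2` or `-2`. -/
def IsParabolic {k : ℕ} {n : ℤ} (ρ : KnotGroup k n →* SL(2, ℂ)) : Prop :=
  IsNonabelian ρ ∧ ((ρ (proj k n fa)).1.trace = 2 ∨ (ρ (proj k n fa)).1.trace = -2)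

/-- The trace `y = tr ρ(ab⁻¹)`. -/
def trY {k : ℕ} {n : ℤ} (ρ : KnotGroup k n →* SL(2, ℂ)) : ℂ :=
  (ρ (proj k n (fa * fb⁻¹))).1.trace

/-- The trace `z = tr ρ(w)`. -/
def trZ {k : ℕ} {n : ℤ} (ρ : KnotGroup k n →* SL(2, ℂ)) : ℂ :=
  (ρ (proj k n (word k))).1.trace

/-- The Chebyshev polynomial of the second kind with `S₀ = 1`, `S₁(v) = v` and
`S_l(v) = v S_{l-1}(v) - S_{l-2}(v)` for all integers `l`, evaluated at `v`. -/
def chebS (l : ℤ) (v : ℂ) : ℂ := (Polynomial.Chebyshev.S ℂ l).eval v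

end DoubleTwist

end

open scoped LaurentPolynomial MatrixGroups Matrix

noncomputable section

namespace DoubleTwist

/-! ### Rules of the Fox calculus -/

section Fox

variable {α : Type} [DecidableEq α] (j : α)

/-! Let A, B, W be the adjoint matrices of the images of a, b, w. The product rule and the group
relation give Φ(∂r/∂a) = Φ(w)^n + (1 - tB)(∑_{i<n} Φ(w)^i) Φ(∂w/∂a), with Φ(w) = W for even k and
Φ(w) = t²W for odd k. This is t^e times a matrix P of polynomials of degree at most d. The extreme
coefficients of det P are the determinants of its top coefficient matrix and of P(0), once these are
nonzero. Up to sign both matrices are products of adjoint matrices, of determinant 1, and of sums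
∑_{j<m} Ad(V)^j, of determinant m S_{m-1}(tr V)² (`det_sum_Ad_pow`). For odd k the top matrix takes
this shape only after a cancellation that uses the relation.

If tr ρ(a) = ±2, the denominator is (1 - t)³. It divides the numerator (`one_sub_T_pow_three_dvd`):
the fundamental formula reads M(tA - 1) + M'(tB - 1) = 0, and multiplying by a matrix Q with (tB -
1)Q = (t - 1)³ shows that (t - 1)³ divides det M times every entry of (tA - 1)Q. At t = 1 the latter
matrix is (A - 1)(B - 1)², which is nonzero because ρ(a) and ρ(b) do not commute.

The Chebyshev factors do not vanish: a zero of S_{m-1} at tr V makes V^m scalar, and this forces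
ρ(a) and ρ(b) to commute. Only S_{m-1}(y) for odd k needs more, namely that the roots of two
Chebyshev expressions have real part at most 2.

A holonomy lift has to be shown parabolic on the meridian. A longitude l commutes with a and has
trivial abelianization. If ρ(a) were diagonalizable with distinct eigenvalues, ρ(l) would be
diagonal in the same basis, and some a^i l^j with (i, j) ≠ 0 would be so close to 1 that
discreteness makes it trivial; then i = 0 and l has finite order. That l has infinite order is seen
in a parabolic representation over the algebraic closure of ℚ₂: there l maps to minus a shear, and
2-adic norms show that the shear is nontrivial. -/

theorem fox_one : fox j (1 : FreeGroup α) = 0 := by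
  simp [fox, foxWord]

theorem fox_inv (g : FreeGroup α) : fox j g⁻¹ = -(MonoidAlgebra.of ℤ _ g⁻¹ * fox j g) := by
  have h := fox_mul j g⁻¹ g
  rw [inv_mul_cancel, fox_one] at h
  exact (neg_eq_of_add_eq_zero_left h.symm).symm

theorem fox_pow (g : FreeGroup α) (n : ℕ) :
    fox j (g ^ n) = (∑ i ∈ Finset.range n, MonoidAlgebra.of ℤ _ g ^ i) * fox j g := by
  induction n with
  | zero => simp [fox_one]
  | succ n ih =>
    rw [pow_succ, fox_mul, ih, Finset.sum_range_succ, add_mul, map_pow]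

/-- The fundamental formula of the Fox calculus, for two generators. -/
theorem fox_fundamental (g : F2) :
    fox 0 g * (MonoidAlgebra.of ℤ _ fa - 1) + fox 1 g * (MonoidAlgebra.of ℤ _ fb - 1) =
      MonoidAlgebra.of ℤ _ g - 1 := by
  have hinv : ∀ x : F2, fox 0 x * (MonoidAlgebra.of ℤ _ fa - 1) +
      fox 1 x * (MonoidAlgebra.of ℤ _ fb - 1) = MonoidAlgebra.of ℤ _ x - 1 →
      fox 0 x⁻¹ * (MonoidAlgebra.of ℤ _ fa - 1) +
      fox 1 x⁻¹ * (MonoidAlgebra.of ℤ _ fb - 1) = MonoidAlgebra.of ℤ _ x⁻¹ - 1 := by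
    intro x hx
    rw [fox_inv, fox_inv, neg_mul, neg_mul, mul_assoc, mul_assoc, ← neg_add, ← mul_add, hx,
      mul_sub, ← map_mul, inv_mul_cancel, map_one, mul_one, neg_sub]
  have hof : ∀ i : Fin 2, fox 0 (FreeGroup.of i) * (MonoidAlgebra.of ℤ _ fa - 1) +
      fox 1 (FreeGroup.of i) * (MonoidAlgebra.of ℤ _ fb - 1) =
      MonoidAlgebra.of ℤ _ (FreeGroup.of i) - 1 := by
    intro i
    rw [fox_of, fox_of]
    fin_cases i <;> simp [fa, fb]
  induction g using FreeGroup.induction_on with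
  | C1 => rw [fox_one, fox_one, map_one]; simp
  | of i => exact hof i
  | inv_of i _ => exact hinv _ (hof i)
  | mul x y hx hy =>
    rw [fox_mul, fox_mul, map_mul]
    have h : MonoidAlgebra.of ℤ _ x * MonoidAlgebra.of ℤ _ y - 1 =
        (MonoidAlgebra.of ℤ _ x - 1) +
          MonoidAlgebra.of ℤ _ x * (MonoidAlgebra.of ℤ _ y - 1) := by
      rw [mul_sub, mul_one]; abel
    rw [h, ← hx, ← hy]
    simp only [add_mul, mul_add, mul_assoc]
    abel

end Fox

/-! ### Matrices of polynomials of bounded degree -/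

section Degree

open Polynomial

variable {ι : Type*}

/-- All entries of `N` have degree at most `d`, and `L` is the matrix of the coefficients of
degree `d`. -/
def HasTop (N : Matrix ι ι ℂ[X]) (d : ℕ) (L : Matrix ι ι ℂ) : Prop :=
  (∀ i j, (N i j).natDegree ≤ d) ∧ ∀ i j, (N i j).coeff d = L i j

theorem HasTop.add {N N' : Matrix ι ι ℂ[X]} {d : ℕ} {L L' : Matrix ι ι ℂ}
    (h : HasTop N d L) (h' : HasTop N' d L') : HasTop (N + N') d (L + L') :=
  ⟨fun i j => (natDegree_add_le _ _).trans (max_le (h.1 i j) (h'.1 i j)),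
    fun i j => by simp [h.2, h'.2]⟩

theorem HasTop.neg {N : Matrix ι ι ℂ[X]} {d : ℕ} {L : Matrix ι ι ℂ}
    (h : HasTop N d L) : HasTop (-N) d (-L) :=
  ⟨fun i j => by simpa using h.1 i j, fun i j => by simp [h.2]⟩

theorem HasTop.sub {N N' : Matrix ι ι ℂ[X]} {d : ℕ} {L L' : Matrix ι ι ℂ}
    (h : HasTop N d L) (h' : HasTop N' d L') : HasTop (N - N') d (L - L') := by
  rw [sub_eq_add_neg, sub_eq_add_neg]
  exact h.add h'.neg

theorem HasTop.mul [Fintype ι] {N N' : Matrix ι ι ℂ[X]} {d d' : ℕ} {L L' : Matrix ι ι ℂ}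
    (h : HasTop N d L) (h' : HasTop N' d' L') : HasTop (N * N') (d + d') (L * L') := by
  refine ⟨fun i j => ?_, fun i j => ?_⟩
  · rw [Matrix.mul_apply]
    refine natDegree_sum_le_of_forall_le _ _ fun x _ => ?_
    exact natDegree_mul_le.trans (add_le_add (h.1 i x) (h'.1 x j))
  · rw [Matrix.mul_apply, finsetSum_coeff, Matrix.mul_apply]
    refine Finset.sum_congr rfl fun x _ => ?_
    rw [coeff_mul_add_eq_of_natDegree_le (h.1 i x) (h'.1 x j), h.2, h'.2]

theorem HasTop.of_lt {N : Matrix ι ι ℂ[X]} {d e : ℕ} {L : Matrix ι ι ℂ}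
    (h : HasTop N d L) (hde : d < e) : HasTop N e 0 :=
  ⟨fun i j => (h.1 i j).trans hde.le, fun i j => by
    rw [Matrix.zero_apply]
    exact coeff_eq_zero_of_natDegree_lt ((h.1 i j).trans_lt hde)⟩

theorem hasTop_const (L : Matrix ι ι ℂ) : HasTop (L.map (C : ℂ →+* ℂ[X])) 0 L :=
  ⟨fun i j => by simp, fun i j => by simp⟩

theorem hasTop_X_pow_smul (d : ℕ) (L : Matrix ι ι ℂ) :
    HasTop ((X ^ d : ℂ[X]) • L.map (C : ℂ →+* ℂ[X])) d L := by
  refine ⟨fun i j => ?_, fun i j => ?_⟩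
  · rw [Matrix.smul_apply, Matrix.map_apply, smul_eq_mul, mul_comm]
    exact natDegree_C_mul_X_pow_le _ _
  · rw [Matrix.smul_apply, Matrix.map_apply, smul_eq_mul, mul_comm, coeff_C_mul_X_pow,
      if_pos rfl]

theorem hasTop_X_smul (L : Matrix ι ι ℂ) :
    HasTop ((X : ℂ[X]) • L.map (C : ℂ →+* ℂ[X])) 1 L := by
  simpa using hasTop_X_pow_smul 1 L

theorem HasTop.det {N : Matrix (Fin 3) (Fin 3) ℂ[X]} {d : ℕ} {L : Matrix (Fin 3) (Fin 3) ℂ}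
    (h : HasTop N d L) : N.det.natDegree ≤ 3 * d ∧ N.det.coeff (3 * d) = L.det := by
  have h3 : ∀ i j k l p q, (N i j * N k l * N p q).natDegree ≤ 3 * d := fun i j k l p q =>
    natDegree_mul_le.trans ((add_le_add (natDegree_mul_le.trans
      (add_le_add (h.1 i j) (h.1 k l))) (h.1 p q)).trans (by omega))
  have c3 : ∀ i j k l p q, (N i j * N k l * N p q).coeff (3 * d) = L i j * L k l * L p q := by
    intro i j k l p q
    rw [show 3 * d = (d + d) + d by ring, coeff_mul_add_eq_of_natDegree_le (natDegree_mul_le.trans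
      (add_le_add (h.1 i j) (h.1 k l))) (h.1 p q),
      coeff_mul_add_eq_of_natDegree_le (h.1 i j) (h.1 k l), h.2, h.2, h.2]
  rw [Matrix.det_fin_three, Matrix.det_fin_three]
  refine ⟨?_, by simp only [coeff_add, coeff_sub, c3]⟩
  have ha : ∀ p q : ℂ[X], p.natDegree ≤ 3 * d → q.natDegree ≤ 3 * d →
      (p + q).natDegree ≤ 3 * d := fun p q hp hq => natDegree_add_le_of_degree_le hp hq
  have hs : ∀ p q : ℂ[X], p.natDegree ≤ 3 * d → q.natDegree ≤ 3 * d →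
      (p - q).natDegree ≤ 3 * d := fun p q hp hq =>
    (natDegree_sub_le_of_le hp hq).trans (max_self _).le
  exact hs _ _ (ha _ _ (ha _ _ (hs _ _ (hs _ _ (h3 ..) (h3 ..)) (h3 ..)) (h3 ..)) (h3 ..)) (h3 ..)

/-! ### Division by (1 - t)³ and passage to Laurent polynomials. -/

theorem dvd_of_toLaurent_dvd {p q : ℂ[X]} (hp : p.coeff 0 ≠ 0)
    (h : toLaurent p ∣ toLaurent q) : p ∣ q := by
  obtain ⟨r, hr⟩ := h
  obtain ⟨n, r', hr'⟩ := LaurentPolynomial.exists_T_pow r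
  have h1 : p ∣ X ^ n * q := by
    refine ⟨r', toLaurent_injective ?_⟩
    rw [map_mul, map_mul, hr, hr', toLaurent_X_pow]
    ring
  -- The constant term of p is a unit and X divides the rest of p, so p is coprime to X and the
  -- power of X can be dropped.
  have h2 : IsCoprime p (X ^ n) := by
    refine IsCoprime.pow_right ?_
    refine ⟨C (p.coeff 0)⁻¹, -(C (p.coeff 0)⁻¹ * p.divX), ?_⟩
    have := divX_mul_X_add p
    have h3 : (C (p.coeff 0)⁻¹ * C (p.coeff 0) : ℂ[X]) = 1 := by
      rw [← C_mul, inv_mul_cancel₀ hp, C_1]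
    linear_combination -C (p.coeff 0)⁻¹ * this + h3
  exact h2.dvd_of_dvd_mul_left h1

theorem coeff_T_mul (e i : ℤ) (f : ℂ[T;T⁻¹]) :
    (LaurentPolynomial.T e * f).coeff i = f.coeff (i - e) := by
  rw [LaurentPolynomial.T, AddMonoidAlgebra.coeff_single_mul_eq_mul_coeff (m₂ := i - e)
    (fun m' _ => by omega), one_mul]

theorem toLaurent_coeff_natCast (p : ℂ[X]) (i : ℕ) :
    (toLaurent p).coeff (i : ℤ) = p.coeff i := by
  rw [LaurentPolynomial.coeff_toLaurent]
  exact Finsupp.mapDomain_apply Nat.castEmbedding.injective _ i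

theorem toLaurent_coeff_neg (p : ℂ[X]) {i : ℤ} (hi : i < 0) : (toLaurent p).coeff i = 0 := by
  rw [LaurentPolynomial.coeff_toLaurent]
  refine Finsupp.mapDomain_of_notMem_range _ _ ?_
  rintro ⟨k, hk⟩
  change (k : ℤ) = i at hk
  omega

theorem algebraMap_mul_div_self {R : Type*} [CommRing R] [IsDomain R] {u : R} (hu : u ≠ 0)
    (v : R) : algebraMap R (FractionRing R) (u * v) / algebraMap R (FractionRing R) u =
      algebraMap R (FractionRing R) v := by
  rw [map_mul, mul_div_cancel_left₀]
  rwa [Ne, FaithfulSMul.algebraMap_eq_zero_iff]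

/-- (1 - X)³ has leading coefficient -1 and constant term 1. Exact division by it therefore lowers
the top degree by 3 and changes the sign of the top coefficient, while the bottom coefficient is
kept. -/
theorem hasExtremeTerms_div (e : ℤ) (N : Matrix (Fin 3) (Fin 3) (Polynomial ℂ)) {d : ℕ} (hd : 1 ≤ d)
    {L L₀ : Matrix (Fin 3) (Fin 3) ℂ} (hL : HasTop N d L)
    (hL₀ : N.map (evalRingHom (0 : ℂ)) = L₀) (hdet : L.det ≠ 0) (hdet₀ : L₀.det ≠ 0)
    (hdvd : (1 - LaurentPolynomial.T 1 : ℂ[T;T⁻¹]) ^ 3 ∣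
      ((LaurentPolynomial.T e : ℂ[T;T⁻¹]) • N.map (toLaurent : ℂ[X] →+* ℂ[T;T⁻¹])).det) :
    HasExtremeTerms (algebraMap ℂ[T;T⁻¹] RatField
      ((LaurentPolynomial.T e : ℂ[T;T⁻¹]) • N.map (toLaurent : ℂ[X] →+* ℂ[T;T⁻¹])).det /
      algebraMap ℂ[T;T⁻¹] RatField ((1 - LaurentPolynomial.T 1) ^ 3))
      (3 * e + 3 * d - 3) (-L.det) (3 * e) L₀.det := by
  have hM : ((LaurentPolynomial.T e : ℂ[T;T⁻¹]) • N.map (toLaurent : ℂ[X] →+* ℂ[T;T⁻¹])).det =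
      LaurentPolynomial.T (3 * e) * toLaurent N.det := by
    rw [Matrix.det_smul, Fintype.card_fin, LaurentPolynomial.T_pow, RingHom.map_det]
    rfl
  have hp : (1 - LaurentPolynomial.T 1 : ℂ[T;T⁻¹]) ^ 3 = toLaurent ((1 - X) ^ 3 : ℂ[X]) := by
    simp
  have h1 : ((1 - X) ^ 3 : ℂ[X]) ∣ N.det := by
    refine dvd_of_toLaurent_dvd (by simp [coeff_zero_eq_eval_zero]) ?_
    rw [← hp]
    rw [hM] at hdvd
    exact (LaurentPolynomial.isUnit_T (R := ℂ) (3 * e)).dvd_mul_left.1 hdvd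
  obtain ⟨Q, hQ⟩ := h1
  have hN₀ : N.det.coeff 0 = L₀.det := by
    rw [coeff_zero_eq_eval_zero, ← coe_evalRingHom, RingHom.map_det, ← hL₀]
    rfl
  obtain ⟨hdeg, hcoef⟩ := hL.det
  have hne : N.det ≠ 0 := by
    intro h
    rw [h, coeff_zero] at hcoef
    exact hdet hcoef.symm
  have hQ0 : Q ≠ 0 := by
    rintro rfl
    exact hne (by rw [hQ, mul_zero])
  have hmon : ((1 - X) ^ 3 : ℂ[X]) = -((X - C 1) ^ 3) := by rw [C_1]; ring
  have hmonic : Monic ((X - C (1 : ℂ)) ^ 3) := (monic_X_sub_C 1).pow 3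
  have hd3 : ((X - C (1 : ℂ)) ^ 3).natDegree = 3 := by
    rw [natDegree_pow, natDegree_X_sub_C]
  have hQdeg : Q.natDegree ≤ 3 * d - 3 := by
    have : N.det.natDegree = 3 + Q.natDegree := by
      rw [hQ, hmon, neg_mul, natDegree_neg, hmonic.natDegree_mul' hQ0, hd3]
    omega
  have hQtop : Q.coeff (3 * d - 3) = -L.det := by
    rw [← hcoef, hQ, hmon, neg_mul, coeff_neg, neg_neg,
      show 3 * d = 3 + (3 * d - 3) by omega, coeff_mul_add_eq_of_natDegree_le hd3.le hQdeg]
    have : ((X - C (1 : ℂ)) ^ 3).coeff 3 = 1 := by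
      have := hmonic.coeff_natDegree
      rwa [hd3] at this
    rw [this, one_mul]
    congr 1
    omega
  have hQbot : Q.coeff 0 = L₀.det := by
    rw [← hN₀, hQ, mul_coeff_zero]
    simp [coeff_zero_eq_eval_zero]
  refine ⟨LaurentPolynomial.T (3 * e) * toLaurent Q, ?_, ⟨?_, neg_ne_zero.2 hdet, ?_⟩,
    ?_, hdet₀, ?_⟩
  · have hnz : ((1 - LaurentPolynomial.T 1 : ℂ[T;T⁻¹]) ^ 3) ≠ 0 := by
      rw [hp, Ne, toLaurent_eq_zero, hmon, neg_eq_zero]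
      exact hmonic.ne_zero
    have hfac : ((LaurentPolynomial.T e : ℂ[T;T⁻¹]) •
        N.map (toLaurent : ℂ[X] →+* ℂ[T;T⁻¹])).det =
        (1 - LaurentPolynomial.T 1) ^ 3 * (LaurentPolynomial.T (3 * e) * toLaurent Q) := by
      rw [hM, hQ, hp, map_mul]
      ring
    rw [hfac]
    exact algebraMap_mul_div_self hnz _
  · rw [coeff_T_mul, show 3 * e + 3 * (d : ℤ) - 3 - 3 * e = ((3 * d - 3 : ℕ) : ℤ) by omega,
      toLaurent_coeff_natCast, hQtop]
  · intro i hi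
    rw [coeff_T_mul]
    obtain ⟨k, hk⟩ := Int.eq_ofNat_of_zero_le (show 0 ≤ i - 3 * e by omega)
    rw [hk, toLaurent_coeff_natCast]
    exact coeff_eq_zero_of_natDegree_lt (by omega)
  · rw [coeff_T_mul, sub_self, ← Nat.cast_zero, toLaurent_coeff_natCast, hQbot]
  · intro i hi
    rw [coeff_T_mul]
    exact toLaurent_coeff_neg _ (by omega)

end Degree

/-! ### The adjoint representation in coordinates -/

theorem Ad_apply (V : SL(2, ℂ)) : Ad V =
    !![V 0 0 ^ 2, -2 * V 0 0 * V 0 1, -V 0 1 ^ 2;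
      -V 0 0 * V 1 0, V 0 0 * V 1 1 + V 0 1 * V 1 0, V 0 1 * V 1 1;
      -V 1 0 ^ 2, 2 * V 1 0 * V 1 1, V 1 1 ^ 2] := by
  have h : ∀ i j, Ad V i j = sl2Equiv (adjointAction V (sl2Equiv.symm (Pi.single j 1))) i := by
    intro i j
    change LinearMap.toMatrix sl2Basis sl2Basis (adjointAction V) i j = _
    rw [LinearMap.toMatrix_apply]
    simp [sl2Basis]
  ext i j
  rw [h]
  have hinv : ((V⁻¹ : SL(2, ℂ)) : Matrix (Fin 2) (Fin 2) ℂ) =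
      !![V 1 1, -V 0 1; -V 1 0, V 0 0] := by
    rw [Matrix.SpecialLinearGroup.SL2_inv_expl]
    rfl
  have hX : ∀ v : Fin 3 → ℂ, (sl2Equiv.symm v).1 = !![v 1, v 0; v 2, -v 1] := fun v => rfl
  have hV : (V : Matrix (Fin 2) (Fin 2) ℂ) = !![V 0 0, V 0 1; V 1 0, V 1 1] :=
    Matrix.eta_fin_two _
  have h2 : (adjointAction V (sl2Equiv.symm (Pi.single j 1))).1 =
      V.1 * (sl2Equiv.symm (Pi.single j 1)).1 * (V⁻¹).1 := rfl
  have h3 : ∀ X : sl2, sl2Equiv X = ![X.1 0 1, X.1 0 0, X.1 1 0] := fun X => rfl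
  rw [h3, h2, hX, hinv, hV]
  fin_cases j <;> fin_cases i <;> simp [Matrix.mul_apply, Fin.sum_univ_two] <;> ring

theorem sl2_det (V : SL(2, ℂ)) : V 0 0 * V 1 1 - V 0 1 * V 1 0 = 1 := by
  rw [← Matrix.det_fin_two]
  exact V.2

theorem Ad_det (V : SL(2, ℂ)) : (Ad V).det = 1 := by
  have h : (Ad V).det = (V 0 0 * V 1 1 - V 0 1 * V 1 0) ^ 3 := by
    rw [Ad_apply, Matrix.det_fin_three]
    simp
    ring
  rw [h, sl2_det, one_pow]

theorem det_one_sub_smul_Ad {R : Type*} [CommRing R] (f : ℂ →+* R) (x : R) (V : SL(2, ℂ))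
    (hV : V.1.trace ^ 2 = 4) : (1 - x • (Ad V).map f).det = (1 - x) ^ 3 := by
  have hf2 : f 2 = 2 := map_ofNat f 2
  -- The characteristic polynomial is homogenized by det V, so that it is an identity in the four
  -- entries; only afterwards is det V put equal to 1.
  have h : (1 - x • (Ad V).map f).det =
      (1 - f (V 0 0 * V 1 1 - V 0 1 * V 1 0) * x) *
        (1 - (f (V 0 0 + V 1 1) ^ 2 - 2 * f (V 0 0 * V 1 1 - V 0 1 * V 1 0)) * x +
          f (V 0 0 * V 1 1 - V 0 1 * V 1 0) ^ 2 * x ^ 2) := by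
    rw [Ad_apply, Matrix.det_fin_three]
    simp [hf2]
    ring
  rw [Matrix.trace_fin_two] at hV
  rw [h, sl2_det, ← map_pow, hV, map_one, show f 4 = 4 from map_ofNat f 4]
  ring

/-- With ε half the trace, V - ε is nilpotent. Square roots of its off-diagonal entries give x and
y, and the diagonal entry is xy up to a sign, which is absorbed into x. -/
theorem exists_parabolic_form (V : SL(2, ℂ)) (hV : V.1.trace ^ 2 = 4) :
    ∃ ε x y : ℂ, ε ^ 2 = 1 ∧ V.1 = !![ε + x * y, -x ^ 2; y ^ 2, ε - x * y] := by
  have hdet := sl2_det V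
  rw [Matrix.trace_fin_two] at hV
  obtain ⟨y, hy⟩ := IsAlgClosed.exists_pow_nat_eq (V 1 0) (n := 2) (by norm_num)
  obtain ⟨x, hx⟩ := IsAlgClosed.exists_pow_nat_eq (-V 0 1) (n := 2) (by norm_num)
  have hxy : ((V 0 0 - V 1 1) / 2) ^ 2 = (x * y) ^ 2 := by
    rw [mul_pow, hx, hy]
    linear_combination hV / 4 - hdet
  have h1 : ((V 0 0 + V 1 1) / 2) ^ 2 = 1 := by linear_combination hV / 4
  rcases sq_eq_sq_iff_eq_or_eq_neg.1 hxy with h | h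
  · refine ⟨(V 0 0 + V 1 1) / 2, x, y, h1, ?_⟩
    rw [← h, hx, hy, Matrix.eta_fin_two V.1]
    congr <;> simp <;> ring
  · refine ⟨(V 0 0 + V 1 1) / 2, -x, y, h1, ?_⟩
    rw [neg_mul, ← h, neg_sq, hx, hy, Matrix.eta_fin_two V.1]
    congr <;> simp <;> ring

/-- The first vector holds the coordinates of the nilpotent part X = V - ε, so every column of (Ad V
- 1)² is a multiple of X. -/
theorem Ad_sub_one_sq {V : SL(2, ℂ)} {ε x y : ℂ} (hε : ε ^ 2 = 1)
    (hV : V.1 = !![ε + x * y, -x ^ 2; y ^ 2, ε - x * y]) :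
    (Ad V - 1) ^ 2 =
      (-2 : ℂ) • Matrix.vecMulVec ![-x ^ 2, x * y, y ^ 2] ![y ^ 2, 2 * (x * y), -x ^ 2] := by
  rw [Ad_apply, sq, hV]
  rcases (mul_self_eq_one_iff.1 ((sq ε).symm.trans hε)) with rfl | rfl <;>
  · ext i j
    fin_cases i <;> fin_cases j <;>
    · simp [Matrix.mul_apply, Fin.sum_univ_three, Matrix.vecMulVec]
      ring

theorem Ad_sub_one_pow_three (V : SL(2, ℂ)) (hV : V.1.trace ^ 2 = 4) : (Ad V - 1) ^ 3 = 0 := by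
  obtain ⟨ε, x, y, hε, h⟩ := exists_parabolic_form V hV
  rw [pow_succ, Ad_sub_one_sq hε h, Ad_apply, h]
  rcases (mul_self_eq_one_iff.1 ((sq ε).symm.trans hε)) with rfl | rfl <;>
  · ext i j
    fin_cases i <;> fin_cases j <;>
    · simp [Matrix.mul_apply, Fin.sum_univ_three, Matrix.vecMulVec]
      ring

theorem Ad_mulVec (V : SL(2, ℂ)) (X : sl2) :
    Ad V *ᵥ sl2Equiv X = sl2Equiv (adjointAction V X) :=
  LinearMap.toMatrix_mulVec_repr sl2Basis sl2Basis (adjointAction V) X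

/-! ### Powers in `SL₂` and Chebyshev polynomials -/

theorem chebS_zero (v : ℂ) : chebS 0 v = 1 := by simp [chebS]

theorem chebS_neg_one (v : ℂ) : chebS (-1) v = 0 := by simp [chebS]

theorem chebS_add_one (l : ℤ) (v : ℂ) : chebS (l + 1) v = v * chebS l v - chebS (l - 1) v := by
  simp [chebS, Polynomial.Chebyshev.S_add_one]

theorem sum_pow_sq_mul (η : ℂ) (hη : η ≠ 0) (m : ℕ) :
    (∑ j ∈ Finset.range m, (η ^ j) ^ 2) * η = η ^ m * chebS ((m : ℤ) - 1) (η + η⁻¹) := by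
  -- Two consecutive indices are carried along, since the Chebyshev recursion has order two.
  have key : ∀ m : ℕ,
      (∑ j ∈ Finset.range m, (η ^ j) ^ 2) * η = η ^ m * chebS ((m : ℤ) - 1) (η + η⁻¹) ∧
      (∑ j ∈ Finset.range (m + 1), (η ^ j) ^ 2) * η =
        η ^ (m + 1) * chebS (m : ℤ) (η + η⁻¹) := by
    intro m
    induction m with
    | zero => simp [chebS_neg_one, chebS_zero]
    | succ m ih =>
      refine ⟨by simpa using ih.2, ?_⟩
      obtain ⟨h1, h2⟩ := ih
      have h3 := chebS_add_one m (η + η⁻¹)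
      push_cast
      rw [h3]
      rw [Finset.sum_range_succ] at h2 ⊢
      rw [Finset.sum_range_succ]
      have h4 : η * η⁻¹ = 1 := mul_inv_cancel₀ hη
      linear_combination (1 + η ^ 2) * h2 - η ^ 2 * h1 -
        η ^ (m + 1) * chebS (↑m) (η + η⁻¹) * h4
  exact (key m).1

theorem exists_triangular (V : SL(2, ℂ)) :
    ∃ P T : SL(2, ℂ), V = P * T * P⁻¹ ∧ T 1 0 = 0 := by
  suffices h : ∃ P : SL(2, ℂ), (P⁻¹ * V * P) 1 0 = 0 by
    obtain ⟨P, hP⟩ := h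
    exact ⟨P, P⁻¹ * V * P, by group, hP⟩
  by_cases hr : V 1 0 = 0
  · exact ⟨1, by simpa using hr⟩
  obtain ⟨μ, hμ⟩ : ∃ μ : ℂ, μ ^ 2 - (V 0 0 + V 1 1) * μ + 1 = 0 := by
    obtain ⟨s, hs⟩ := IsAlgClosed.exists_pow_nat_eq ((V 0 0 + V 1 1) ^ 2 - 4) (n := 2) (by norm_num)
    exact ⟨(V 0 0 + V 1 1 + s) / 2, by linear_combination hs / 4⟩
  -- The first column is an eigenvector of V for the eigenvalue μ; the second makes the determinant
  -- 1.
  let P : SL(2, ℂ) := ⟨!![μ - V 1 1, -(V 1 0)⁻¹; V 1 0, 0], by simp [Matrix.det_fin_two, hr]⟩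
  refine ⟨P, ?_⟩
  have hP : ((P⁻¹ : SL(2, ℂ)) : Matrix (Fin 2) (Fin 2) ℂ) =
      !![P 1 1, -P 0 1; -P 1 0, P 0 0] := by
    rw [Matrix.SpecialLinearGroup.SL2_inv_expl]
    rfl
  rw [Matrix.SpecialLinearGroup.coe_mul, Matrix.SpecialLinearGroup.coe_mul, hP]
  have h00 : P 0 0 = μ - V 1 1 := rfl
  have h10 : P 1 0 = V 1 0 := rfl
  simp only [Matrix.mul_apply, Fin.sum_univ_two, h00, h10]
  simp
  linear_combination V 1 0 * hμ + V 1 0 * sl2_det V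

/-- After conjugation V is triangular with diagonal η, η⁻¹, and Ad V is triangular with diagonal η²,
1, η⁻². The middle entry contributes m; the geometric sums for η² and η⁻² each contribute one
Chebyshev factor, and the powers of η cancel. -/
theorem det_sum_Ad_pow (V : SL(2, ℂ)) (m : ℕ) :
    (∑ j ∈ Finset.range m, Ad V ^ j).det = m * chebS ((m : ℤ) - 1) V.1.trace ^ 2 := by
  obtain ⟨P, T, rfl, hT⟩ := exists_triangular V
  have hdet : T 0 0 * T 1 1 = 1 := by
    have := sl2_det T
    rwa [hT, mul_zero, sub_zero] at this
  have hη : T 0 0 ≠ 0 := left_ne_zero_of_mul_eq_one hdet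
  have hinv : T 1 1 = (T 0 0)⁻¹ := eq_inv_of_mul_eq_one_right hdet
  have htr : (P * T * P⁻¹).1.trace = T 0 0 + (T 0 0)⁻¹ := by
    rw [Matrix.SpecialLinearGroup.coe_mul, Matrix.trace_mul_comm,
      ← Matrix.SpecialLinearGroup.coe_mul, inv_mul_cancel_left, Matrix.trace_fin_two, hinv]
  have hpow : ∀ j : ℕ, (T ^ j) 1 0 = 0 ∧ (T ^ j) 0 0 = T 0 0 ^ j ∧
      (T ^ j) 1 1 = ((T 0 0)⁻¹) ^ j := by
    intro j
    induction j with
    | zero => simp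
    | succ j ih =>
      obtain ⟨h1, h2, h3⟩ := ih
      rw [pow_succ, Matrix.SpecialLinearGroup.coe_mul]
      simp only [Matrix.mul_apply, Fin.sum_univ_two, h1, h2, h3, hT, hinv, pow_succ]
      simp
  have hsum : (∑ j ∈ Finset.range m, Ad T ^ j).det = m *
      ((∑ j ∈ Finset.range m, (T 0 0 ^ j) ^ 2) *
        ∑ j ∈ Finset.range m, ((T 0 0)⁻¹ ^ j) ^ 2) := by
    have hsum' : (∑ j ∈ Finset.range m, Ad T ^ j) = ∑ j ∈ Finset.range m, Ad (T ^ j) := by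
      simp only [map_pow]
    have hprod : ∀ j : ℕ, T 0 0 ^ j * (T 0 0)⁻¹ ^ j = 1 := fun j => by
      rw [← mul_pow, mul_inv_cancel₀ hη, one_pow]
    rw [hsum', Matrix.det_fin_three]
    simp only [Matrix.sum_apply, Ad_apply, hpow]
    simp only [Matrix.of_apply, Matrix.cons_val, mul_zero, zero_mul, add_zero, neg_zero,
      Finset.sum_const_zero, sub_zero, hprod, Finset.sum_const, Finset.card_range, nsmul_eq_mul,
      mul_one, zero_pow two_ne_zero]
    ring
  have hconj : (∑ j ∈ Finset.range m, Ad (P * T * P⁻¹) ^ j) =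
      Ad P * (∑ j ∈ Finset.range m, Ad T ^ j) * Ad P⁻¹ := by
    rw [Finset.mul_sum, Finset.sum_mul]
    refine Finset.sum_congr rfl fun j _ => ?_
    rw [← map_pow, conj_pow, map_mul, map_mul, map_pow]
  rw [hconj, Matrix.det_mul, Matrix.det_mul, Ad_det, Ad_det, one_mul, mul_one, hsum, htr]
  have h1 := sum_pow_sq_mul (T 0 0) hη m
  have h2 := sum_pow_sq_mul (T 0 0)⁻¹ (inv_ne_zero hη) m
  rw [inv_inv, add_comm (T 0 0)⁻¹] at h2
  have h3 : (T 0 0) ^ m * (T 0 0)⁻¹ ^ m = 1 := by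
    rw [← mul_pow, mul_inv_cancel₀ hη, one_pow]
  have h4 : (T 0 0) * (T 0 0)⁻¹ = 1 := mul_inv_cancel₀ hη
  have h5 := congrArg₂ (· * ·) h1 h2
  rw [mul_mul_mul_comm, h4, mul_one, mul_mul_mul_comm, h3, one_mul] at h5
  rw [h5, sq]

/-! ### The matrices of the twisted Fox calculus -/

/-- Constant matrices of Laurent polynomials. -/
def lc : Matrix (Fin 3) (Fin 3) ℂ →+* Matrix (Fin 3) (Fin 3) ℂ[T;T⁻¹] :=
  (LaurentPolynomial.C : ℂ →+* ℂ[T;T⁻¹]).mapMatrix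

/-- Constant matrices of polynomials. -/
def pc : Matrix (Fin 3) (Fin 3) ℂ →+* Matrix (Fin 3) (Fin 3) (Polynomial ℂ) :=
  (Polynomial.C : ℂ →+* Polynomial ℂ).mapMatrix

/-- Matrices of polynomials as matrices of Laurent polynomials. -/
def pl : Matrix (Fin 3) (Fin 3) (Polynomial ℂ) →+* Matrix (Fin 3) (Fin 3) ℂ[T;T⁻¹] :=
  (Polynomial.toLaurent : Polynomial ℂ →+* ℂ[T;T⁻¹]).mapMatrix

/-- Evaluation of a matrix of polynomials at a point. -/
def pev (c : ℂ) : Matrix (Fin 3) (Fin 3) (Polynomial ℂ) →+* Matrix (Fin 3) (Fin 3) ℂ :=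
  (Polynomial.evalRingHom c).mapMatrix

theorem pl_pc (L : Matrix (Fin 3) (Fin 3) ℂ) : pl (pc L) = lc L := by
  ext1 i j
  exact Polynomial.toLaurent_C _

theorem pl_smul (p : Polynomial ℂ) (N : Matrix (Fin 3) (Fin 3) (Polynomial ℂ)) :
    pl (p • N) = Polynomial.toLaurent p • pl N := by
  ext1 i j
  exact map_mul Polynomial.toLaurent _ _

theorem pl_X_smul (N : Matrix (Fin 3) (Fin 3) (Polynomial ℂ)) :
    pl ((Polynomial.X : Polynomial ℂ) • N) = (LaurentPolynomial.T 1 : ℂ[T;T⁻¹]) • pl N := by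
  rw [pl_smul, Polynomial.toLaurent_X]

theorem pev_pc (c : ℂ) (L : Matrix (Fin 3) (Fin 3) ℂ) : pev c (pc L) = L := by
  ext1 i j
  exact Polynomial.eval_C

theorem pev_smul (c : ℂ) (p : Polynomial ℂ) (N : Matrix (Fin 3) (Fin 3) (Polynomial ℂ)) :
    pev c (p • N) = p.eval c • pev c N := by
  ext1 i j
  exact Polynomial.eval_mul

section Rep

variable {k : ℕ} {n : ℤ} (ρ : KnotGroup k n →* SL(2, ℂ))

theorem Phi_of (g : F2) : Phi ρ (MonoidAlgebra.of ℤ _ g) =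
    (LaurentPolynomial.T (Multiplicative.toAdd (abel k n (proj k n g))) : ℂ[T;T⁻¹]) •
      lc (Ad (ρ (proj k n g))) := by
  rw [Phi, MonoidAlgebra.lift_of]
  rfl

theorem abel_fa : abel k n (proj k n fa) = Multiplicative.ofAdd 1 :=
  PresentedGroup.toGroup.of _

theorem abel_fb : abel k n (proj k n fb) = Multiplicative.ofAdd 1 :=
  PresentedGroup.toGroup.of _

theorem proj_relator : proj k n (relator k n) = 1 :=
  PresentedGroup.one_of_mem (Set.mem_singleton _)

theorem proj_conj : proj k n (word k ^ n * fa * (word k ^ n)⁻¹) = proj k n fb := by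
  have h : proj k n (word k ^ n * fa * word k ^ (-n) * fb⁻¹) = 1 := proj_relator
  rw [map_mul, map_inv, mul_inv_eq_one, zpow_neg] at h
  exact h

theorem Phi_fa : Phi ρ (MonoidAlgebra.of ℤ _ fa) =
    (LaurentPolynomial.T 1 : ℂ[T;T⁻¹]) • lc (Ad (ρ (proj k n fa))) := by
  rw [Phi_of, abel_fa]; rfl

theorem Phi_fb : Phi ρ (MonoidAlgebra.of ℤ _ fb) =
    (LaurentPolynomial.T 1 : ℂ[T;T⁻¹]) • lc (Ad (ρ (proj k n fb))) := by
  rw [Phi_of, abel_fb]; rfl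

theorem Phi_fb_inv : Phi ρ (MonoidAlgebra.of ℤ _ fb⁻¹) =
    (LaurentPolynomial.T (-1) : ℂ[T;T⁻¹]) • lc (Ad (ρ (proj k n fb))⁻¹) := by
  rw [Phi_of, map_inv (proj k n), map_inv (abel k n), abel_fb, map_inv ρ]; rfl

theorem Phi_of_abel_eq_one (g : F2) (hg : abel k n (proj k n g) = 1) :
    Phi ρ (MonoidAlgebra.of ℤ _ g) = lc (Ad (ρ (proj k n g))) := by
  rw [Phi_of, hg, toAdd_one, LaurentPolynomial.T_zero, one_smul]

/-- In the group ring ∂r/∂a = wⁿ + (1 - wⁿ a w⁻ⁿ) ∂(wⁿ)/∂a, and under Φ the conjugate wⁿ a w⁻ⁿ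
becomes b. -/
theorem Phi_fox_relator (N : ℕ) (ρ : KnotGroup k (N : ℤ) →* SL(2, ℂ)) :
    Phi ρ (fox 0 (relator k N)) = Phi ρ (MonoidAlgebra.of ℤ _ (word k)) ^ N +
      (1 - Phi ρ (MonoidAlgebra.of ℤ _ fb)) *
        (∑ i ∈ Finset.range N, Phi ρ (MonoidAlgebra.of ℤ _ (word k)) ^ i) *
          Phi ρ (fox 0 (word k)) := by
  have hb : fox (0 : Fin 2) fb = 0 := by rw [fb, fox_of]; rfl
  have ha : fox (0 : Fin 2) fa = 1 := by rw [fa, fox_of]; rfl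
  have h := proj_conj (k := k) (n := N)
  have hconj : Phi ρ (MonoidAlgebra.of ℤ _ (word k ^ N * fa * (word k ^ N)⁻¹)) =
      Phi ρ (MonoidAlgebra.of ℤ _ fb) := by
    rw [Phi_of, Phi_of, ← zpow_natCast, h]
  have hfox : fox 0 (relator k N) = MonoidAlgebra.of ℤ _ (word k) ^ N +
      (1 - MonoidAlgebra.of ℤ _ (word k ^ N * fa * (word k ^ N)⁻¹)) * fox 0 (word k ^ N) := by
    rw [relator, zpow_neg, zpow_natCast, fox_mul, fox_inv 0 fb, hb, mul_zero, neg_zero, mul_zero,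
      add_zero, fox_mul, fox_mul, ha, fox_inv, map_mul _ (word k ^ N * fa), sub_mul, one_mul,
      mul_one, map_pow, mul_neg, mul_assoc]
    abel
  rw [hfox, map_add, map_mul, map_sub, map_one, hconj, fox_pow, map_mul, map_sum, map_pow,
    ← mul_assoc]
  simp only [map_pow]

/-! ### Divisibility for parabolic representations -/

theorem trace_fb (ρ : KnotGroup k n →* SL(2, ℂ)) :
    (ρ (proj k n fb)).1.trace = (ρ (proj k n fa)).1.trace := by
  rw [← proj_conj, map_mul, map_mul, map_inv, map_mul, map_mul, map_inv,
    Matrix.SpecialLinearGroup.coe_mul, Matrix.trace_mul_comm, ← Matrix.SpecialLinearGroup.coe_mul,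
    inv_mul_cancel_left]

theorem IsParabolic.trace_sq {ρ : KnotGroup k n →* SL(2, ℂ)} (h : IsParabolic ρ) :
    (ρ (proj k n fa)).1.trace ^ 2 = 4 := by
  rcases h.2 with h | h <;> rw [h] <;> norm_num

theorem IsNonabelian.not_commute {ρ : KnotGroup k n →* SL(2, ℂ)} (h : IsNonabelian ρ) :
    ρ (proj k n fa) * ρ (proj k n fb) ≠ ρ (proj k n fb) * ρ (proj k n fa) := by
  intro hc
  obtain ⟨g, g', hg⟩ := h
  obtain ⟨x, rfl⟩ := PresentedGroup.mk_surjective _ g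
  obtain ⟨x', rfl⟩ := PresentedGroup.mk_surjective _ g'
  apply hg
  have hgen : ∀ i j : Fin 2,
      Commute (ρ (proj k n (FreeGroup.of i))) (ρ (proj k n (FreeGroup.of j))) := by
    intro i j
    fin_cases i <;> fin_cases j
    · exact Commute.refl _
    · exact hc
    · exact Commute.symm hc
    · exact Commute.refl _
  have hl : ∀ (i : Fin 2) (x : F2), Commute (ρ (proj k n (FreeGroup.of i))) (ρ (proj k n x)) := by
    intro i x
    induction x using FreeGroup.induction_on with
    | C1 => rw [map_one, map_one]; exact Commute.one_right _
    | of j => exact hgen i j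
    | inv_of j h => rw [map_inv, map_inv]; exact h.inv_right
    | mul x y hx hy => rw [map_mul, map_mul]; exact hx.mul_right hy
  have hall : ∀ x y : F2, Commute (ρ (proj k n x)) (ρ (proj k n y)) := by
    intro x y
    induction x using FreeGroup.induction_on with
    | C1 => rw [map_one, map_one]; exact Commute.one_left _
    | of j => exact hl j y
    | inv_of j h => rw [map_inv, map_inv]; exact h.inv_left
    | mul x z hx hz => rw [map_mul, map_mul]; exact hx.mul_left hz
  exact hall x x'

/-- The image of (Ad B - 1)² is spanned by the nilpotent part X of B = ε + X. If Ad A fixed X, then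
A would commute with X and hence with B. -/
theorem Ad_sub_one_mul_sq_ne_zero {A B : SL(2, ℂ)} (hB : B.1.trace ^ 2 = 4) (hAB : A * B ≠ B * A) :
    (Ad A - 1) * (Ad B - 1) ^ 2 ≠ 0 := by
  intro h
  obtain ⟨ε, x, y, hε, hB⟩ := exists_parabolic_form B hB
  rw [Ad_sub_one_sq hε hB, Matrix.mul_smul, smul_eq_zero, Matrix.mul_vecMulVec] at h
  have h := h.resolve_left (by norm_num)
  have hfix : (Ad A - 1) *ᵥ ![-x ^ 2, x * y, y ^ 2] = 0 := by
    rw [Matrix.vecMulVec_eq_zero] at h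
    refine h.resolve_right fun h0 => hAB ?_
    have hy : y = 0 := by simpa using congrFun h0 0
    have hx : x = 0 := by simpa using congrFun h0 2
    apply Subtype.ext
    rw [Matrix.SpecialLinearGroup.coe_mul, Matrix.SpecialLinearGroup.coe_mul, hB, hx, hy]
    ext i j
    fin_cases i <;> fin_cases j <;> simp [Matrix.mul_apply, Fin.sum_univ_two, mul_comm]
  rw [Matrix.sub_mulVec, Matrix.one_mulVec, sub_eq_zero] at hfix
  let X : sl2 := ⟨!![x * y, -x ^ 2; y ^ 2, -(x * y)], mem_sl2 (by simp [Matrix.trace_fin_two])⟩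
  have hX : sl2Equiv X = ![-x ^ 2, x * y, y ^ 2] := rfl
  rw [← hX, Ad_mulVec] at hfix
  have h1 : A.1 * X.1 * (A⁻¹).1 = X.1 := congrArg Subtype.val (sl2Equiv.injective hfix)
  have h2 : A.1 * X.1 = X.1 * A.1 := by
    conv_rhs => rw [← h1]
    rw [mul_assoc _ (A⁻¹).1, ← Matrix.SpecialLinearGroup.coe_mul, inv_mul_cancel,
      Matrix.SpecialLinearGroup.coe_one, mul_one]
  have hBX : B.1 = ε • 1 + X.1 := by
    rw [hB]
    ext i j
    fin_cases i <;> fin_cases j <;> simp [X, sub_eq_add_neg]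
  apply hAB
  apply Subtype.ext
  rw [Matrix.SpecialLinearGroup.coe_mul, Matrix.SpecialLinearGroup.coe_mul, hBX, mul_add, add_mul,
    h2, Matrix.mul_smul, Matrix.smul_mul, mul_one, one_mul]

theorem one_sub_T_pow_three_dvd (ρ : KnotGroup k n →* SL(2, ℂ)) (hρ : IsParabolic ρ) :
    (1 - LaurentPolynomial.T 1 : ℂ[T;T⁻¹]) ^ 3 ∣ (Phi ρ (fox 0 (relator k n))).det := by
  set M := Phi ρ (fox 0 (relator k n))
  set A := Ad (ρ (proj k n fa))
  set B := Ad (ρ (proj k n fb))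
  set t : ℂ[T;T⁻¹] := LaurentPolynomial.T 1
  have htB : (ρ (proj k n fb)).1.trace ^ 2 = 4 := by rw [trace_fb, hρ.trace_sq]
  have hfox : M * (t • lc A - 1) + Phi ρ (fox 1 (relator k n)) * (t • lc B - 1) = 0 := by
    have h := congrArg (Phi ρ) (fox_fundamental (relator k n))
    rw [map_add, map_mul, map_mul, map_sub, map_sub, map_sub, map_one, Phi_fa, Phi_fb,
      Phi_of_abel_eq_one _ _ (by rw [proj_relator, map_one]), proj_relator, map_one, map_one,
      map_one, sub_self] at h
    exact h
  let x : Polynomial ℂ := Polynomial.X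
  let Z := B - 1
  -- With Z = B - 1 nilpotent of order 3, xB - 1 = (x - 1) + xZ is inverted by a finite geometric
  -- series; Q is that inverse multiplied by (x - 1)³.
  let Q : Matrix (Fin 3) (Fin 3) (Polynomial ℂ) :=
    (x - 1) ^ 2 • 1 - ((x - 1) * x) • pc Z + x ^ 2 • pc Z ^ 2
  have hZ : Z ^ 3 = 0 := Ad_sub_one_pow_three _ htB
  have hQ : (x • pc B - 1) * Q = (x - 1) ^ 3 • 1 := by
    have hB : x • pc B - 1 = (x - 1) • 1 + x • pc Z := by
      rw [show B = 1 + Z by simp [Z], map_add, map_one, smul_add, sub_smul, one_smul]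
      abel
    have hZ' : pc Z * (pc Z * pc Z) = 0 := by
      rw [← map_mul, ← map_mul, ← mul_assoc, ← sq, ← pow_succ, hZ, map_zero]
    rw [hB]
    simp only [Q, sq (pc Z), add_mul, mul_add, mul_sub, Matrix.smul_mul, Matrix.mul_smul, one_mul,
      mul_one, smul_smul, hZ', smul_zero]
    module
  have hQ' : (t • lc B - 1) * pl Q = (t - 1) ^ 3 • 1 := by
    have := congrArg pl hQ
    rwa [map_mul, map_sub, pl_X_smul, pl_pc, map_one, pl_smul, map_one, map_pow, map_sub,
      Polynomial.toLaurent_X, map_one] at this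
  have hM : M * ((t • lc A - 1) * pl Q) =
      -((t - 1) ^ 3 • Phi ρ (fox 1 (relator k n))) := by
    rw [← mul_assoc, eq_neg_of_add_eq_zero_left hfox, neg_mul, mul_assoc, hQ', Matrix.mul_smul,
      mul_one]
  have hadj : M.det • ((t • lc A - 1) * pl Q) =
      -((t - 1) ^ 3 • (M.adjugate * Phi ρ (fox 1 (relator k n)))) := by
    have := congrArg (M.adjugate * ·) hM
    rwa [← mul_assoc, Matrix.adjugate_mul, Matrix.smul_mul, one_mul, mul_neg,
      Matrix.mul_smul] at this
  let E := (x • pc A - 1) * Q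
  have hE : pl E = (t • lc A - 1) * pl Q := by
    rw [map_mul, map_sub, pl_X_smul, pl_pc, map_one]
  have hE1 : pev 1 E = (A - 1) * Z ^ 2 := by
    simp only [E, Q, map_mul, map_sub, map_add, map_pow, pev_smul, pev_pc, map_one, x,
      Polynomial.eval_X, Polynomial.eval_pow, Polynomial.eval_sub, Polynomial.eval_one,
      Polynomial.eval_mul, sub_self]
    simp
  have hne : pev 1 E ≠ 0 := by
    rw [hE1]
    exact Ad_sub_one_mul_sq_ne_zero htB hρ.1.not_commute
  obtain ⟨i, j, hij⟩ : ∃ i j, (E i j).eval 1 ≠ 0 := by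
    by_contra! h
    exact hne (by ext i j; exact h i j)
  -- An entry of E that does not vanish at 1 is coprime to (1 - t)³, so the whole factor has to
  -- divide det M.
  have hcop : IsCoprime ((1 - t) ^ 3) (Polynomial.toLaurent (E i j)) := by
    refine IsCoprime.pow_left ?_
    have h1 : IsCoprime (Polynomial.X - Polynomial.C 1) (E i j) := by
      refine ((Polynomial.irreducible_X_sub_C (1 : ℂ)).coprime_iff_not_dvd).2 fun h => hij ?_
      exact Polynomial.dvd_iff_isRoot.1 h
    have h2 := h1.map (Polynomial.toLaurent : Polynomial ℂ →+* ℂ[T;T⁻¹])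
    rw [map_sub, Polynomial.toLaurent_X, Polynomial.C_1, map_one] at h2
    have h3 := h2.neg_left
    rwa [neg_sub] at h3
  refine hcop.dvd_of_dvd_mul_right ?_
  have hent := congrFun (congrFun hadj i) j
  rw [← hE] at hent
  have h4 : M.det * Polynomial.toLaurent (E i j) =
      -((t - 1) ^ 3 * (M.adjugate * Phi ρ (fox 1 (relator k n))) i j) := hent
  rw [h4]
  exact ⟨(M.adjugate * Phi ρ (fox 1 (relator k n))) i j, by ring⟩

theorem det_Phi_one_sub (ρ : KnotGroup k n →* SL(2, ℂ)) (hρ : IsParabolic ρ) :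
    (Phi ρ (1 - MonoidAlgebra.of ℤ _ fb)).det = (1 - LaurentPolynomial.T 1) ^ 3 := by
  rw [map_sub, map_one, Phi_fb]
  exact det_one_sub_smul_Ad _ _ _ (by rw [trace_fb, hρ.trace_sq])

theorem hasExtremeTerms_adjointAlexander (ρ : KnotGroup k n →* SL(2, ℂ)) (hρ : IsParabolic ρ)
    (e : ℤ) (N : Matrix (Fin 3) (Fin 3) (Polynomial ℂ)) {d : ℕ} (hd : 1 ≤ d)
    {L L₀ : Matrix (Fin 3) (Fin 3) ℂ}
    (hM : Phi ρ (fox 0 (relator k n)) = (LaurentPolynomial.T e : ℂ[T;T⁻¹]) • pl N)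
    (hL : HasTop N d L) (hL₀ : pev 0 N = L₀) (hdet : L.det ≠ 0) (hdet₀ : L₀.det ≠ 0) :
    HasExtremeTerms (adjointAlexander ρ) (3 * e + 3 * d - 3) (-L.det) (3 * e) L₀.det := by
  have h := one_sub_T_pow_three_dvd ρ hρ
  rw [hM] at h
  rw [adjointAlexander, det_Phi_one_sub ρ hρ, hM]
  exact hasExtremeTerms_div e N hd hL hL₀ hdet hdet₀ h

end Rep

/-! ### Powers in `SL₂` and Chebyshev polynomials -/

theorem mul_self_of_det_eq_one {R : Type*} [CommRing R] (V : Matrix (Fin 2) (Fin 2) R)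
    (hV : V.det = 1) : V * V = V.trace • V - 1 := by
  rw [Matrix.det_fin_two] at hV
  rw [Matrix.trace_fin_two]
  ext i j
  fin_cases i <;> fin_cases j <;> simp [Matrix.mul_apply, Fin.sum_univ_two] <;>
    first | linear_combination -hV | ring

theorem pow_eq_chebyshev {R : Type*} [CommRing R] (V : Matrix (Fin 2) (Fin 2) R)
    (hV : V.det = 1) (n : ℕ) :
    V ^ n = (Polynomial.Chebyshev.S R ((n : ℤ) - 1)).eval V.trace • V -
      (Polynomial.Chebyshev.S R ((n : ℤ) - 2)).eval V.trace • 1 := by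
  induction n with
  | zero => simp
  | succ n ih =>
    have h := congrArg (Polynomial.eval V.trace) (Polynomial.Chebyshev.S_add_one R ((n : ℤ) - 1))
    rw [Polynomial.eval_sub, Polynomial.eval_mul, Polynomial.eval_X, sub_add_cancel,
      sub_sub, one_add_one_eq_two] at h
    rw [pow_succ, ih, sub_mul, Matrix.smul_mul, mul_self_of_det_eq_one V hV, Matrix.smul_mul,
      one_mul]
    push_cast
    rw [add_sub_cancel_right, h, show (n : ℤ) + 1 - 2 = n - 1 by ring]
    module

theorem commute_of_eq_smul_one {V : SL(2, ℂ)} {s : ℂ} (h : V.1 = s • 1) (X : SL(2, ℂ)) :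
    Commute V X := by
  apply Subtype.ext
  rw [Matrix.SpecialLinearGroup.coe_mul, Matrix.SpecialLinearGroup.coe_mul, h, Matrix.smul_mul,
    Matrix.mul_smul, one_mul, mul_one]

/-- By Cayley–Hamilton Vⁿ = S_{n-1}(v) V - S_{n-2}(v), so only the scalar term survives. -/
theorem pow_eq_smul_one {V : SL(2, ℂ)} {v : ℂ} (hv : V.1.trace = v) {n : ℕ}
    (h : chebS ((n : ℤ) - 1) v = 0) : (V ^ n).1 = (-chebS ((n : ℤ) - 2) v) • 1 := by
  have := pow_eq_chebyshev V.1 V.2 n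
  rw [Matrix.SpecialLinearGroup.coe_pow, this, hv]
  unfold chebS at h ⊢
  rw [h, zero_smul, zero_sub, neg_smul]

theorem trace_inv (V : SL(2, ℂ)) : (V⁻¹).1.trace = V.1.trace := by
  rw [Matrix.SpecialLinearGroup.SL2_inv_expl, Matrix.trace_fin_two, Matrix.trace_fin_two]
  exact add_comm _ _

/-! ### Unimodularity of the roots of some Chebyshev polynomials -/

theorem exists_add_inv (v : ℂ) : ∃ η : ℂ, η ≠ 0 ∧ v = η + η⁻¹ := by
  obtain ⟨s, hs⟩ := IsAlgClosed.exists_pow_nat_eq (v ^ 2 - 4) (n := 2) (by norm_num)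
  have h : ((v + s) / 2) * ((v - s) / 2) = 1 := by linear_combination -hs / 4
  exact ⟨(v + s) / 2, left_ne_zero_of_mul_eq_one h, by rw [← eq_inv_of_mul_eq_one_right h]; ring⟩

theorem re_add_inv_of_norm {η : ℂ} (h : ‖η‖ = 1) : (η + η⁻¹).re = 2 * η.re := by
  rw [Complex.inv_eq_conj h]
  simp [two_mul]

theorem re_le_one_of_norm {η : ℂ} (h : ‖η‖ = 1) : η.re ≤ 1 := (Complex.re_le_norm η).trans h.le

/-- Writing y = η + η⁻¹, the hypothesis gives η^{2m} = 1, so y = 2 Re η ≤ 2. Equality would mean η =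
1, but S_{m-1}(2) = m is not zero. -/
theorem re_lt_two_of_chebS_eq_zero {m : ℕ} (hm : 1 ≤ m) {y : ℂ} (h : chebS ((m : ℤ) - 1) y = 0) :
    y.re < 2 := by
  obtain ⟨η, hη, rfl⟩ := exists_add_inv y
  have h1 := sum_pow_sq_mul η hη m
  rw [h, mul_zero, mul_eq_zero, or_iff_left hη] at h1
  have h2 : η ^ (2 * m) = 1 := by
    have := geom_sum_mul (η ^ 2) m
    simp only [← pow_mul, mul_comm 2] at this h1
    rw [h1, zero_mul] at this
    rw [mul_comm]
    exact (sub_eq_zero.1 this.symm)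
  have h3 : ‖η‖ = 1 := Complex.norm_eq_one_of_pow_eq_one h2 (by omega)
  rw [re_add_inv_of_norm h3]
  refine lt_of_le_of_ne (by linarith [re_le_one_of_norm h3]) fun h4 => ?_
  have h5 : η.re = 1 := by linarith
  have h6 : η = 1 := by
    have h7 := Complex.sq_norm η
    rw [h3, Complex.normSq_apply, h5] at h7
    apply Complex.ext h5
    simp only [Complex.one_im]
    nlinarith
  rw [h6, inv_one, one_add_one_eq_two, chebS, Polynomial.Chebyshev.S_eval_two] at h
  push_cast at h
  rw [sub_add_cancel] at h
  exact (Nat.cast_ne_zero.2 (by omega : m ≠ 0)) h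

/-- Writing z = ζ + ζ⁻¹, the hypothesis becomes (ζ^{2n+1} + 1)(ζ - 1) = 0, so ζ has modulus 1. -/
theorem re_le_two_of_chebS_eq {n : ℕ} {z : ℂ}
    (h : chebS (n : ℤ) z = chebS ((n : ℤ) - 1) z) : z.re ≤ 2 := by
  obtain ⟨ζ, hζ, rfl⟩ := exists_add_inv z
  have h1 := sum_pow_sq_mul ζ hζ n
  have h2 := sum_pow_sq_mul ζ hζ (n + 1)
  rw [Nat.cast_add, Nat.cast_one, add_sub_cancel_right, h, pow_succ, mul_right_comm, ← h1] at h2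
  have h3 := mul_right_cancel₀ hζ h2
  have g1 := geom_sum_mul (ζ ^ 2) n
  have g2 := geom_sum_mul (ζ ^ 2) (n + 1)
  simp only [← pow_mul, mul_comm 2] at g1 g2 h3
  have h4 : (ζ ^ (2 * n + 1) + 1) * (ζ - 1) = 0 := by
    rw [h3] at g2
    ring_nf at g1 g2 ⊢
    linear_combination -g2 + ζ * g1
  have h5 : ‖ζ‖ = 1 := by
    rcases mul_eq_zero.1 h4 with h | h
    · have h6 : ζ ^ (2 * (2 * n + 1)) = 1 := by
        rw [mul_comm, pow_mul, eq_neg_of_add_eq_zero_left h]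
        norm_num
      exact Complex.norm_eq_one_of_pow_eq_one h6 (by omega)
    · rw [sub_eq_zero.1 h, norm_one]
  rw [re_add_inv_of_norm h5]
  linarith [re_le_one_of_norm h5]

/-! ### The word `w` -/

theorem word_even (m : ℕ) : word (2 * m) = (fb * fa⁻¹) ^ m * (fb⁻¹ * fa) ^ m := by
  rw [word, if_pos (even_two_mul m), Nat.mul_div_cancel_left _ two_pos, mul_one]

theorem word_odd (m : ℕ) :
    word (2 * m + 1) = (fb * fa⁻¹) ^ m * (fb * fa) * (fb⁻¹ * fa) ^ m := by
  rw [word, if_neg (by simp), show (2 * m + 1) / 2 = m by omega]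

section Fox

open MonoidAlgebra

theorem fox_fb : fox (0 : Fin 2) fb = 0 := by rw [fb, fox_of]; rfl

theorem fox_fa : fox (0 : Fin 2) fa = 1 := by rw [fa, fox_of]; rfl

theorem fox_c : fox (0 : Fin 2) (fb * fa⁻¹) = -of ℤ _ (fb * fa⁻¹) := by
  rw [fox_mul, fox_fb, fox_inv, fox_fa, zero_add, mul_one, mul_neg, ← map_mul]

theorem fox_d : fox (0 : Fin 2) (fb⁻¹ * fa) = of ℤ _ fb⁻¹ := by
  rw [fox_mul, fox_inv, fox_fb, fox_fa, mul_zero, neg_zero, zero_add, mul_one]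

theorem fox_word_even (m : ℕ) : fox 0 (word (2 * m)) =
    -((∑ i ∈ Finset.range m, of ℤ _ (fb * fa⁻¹) ^ i) * of ℤ _ (fb * fa⁻¹)) +
      of ℤ _ (fb * fa⁻¹) ^ m * ((∑ i ∈ Finset.range m, of ℤ _ (fb⁻¹ * fa) ^ i) * of ℤ _ fb⁻¹) := by
  rw [word_even, fox_mul, fox_pow, fox_pow, fox_c, fox_d, mul_neg, map_pow]

theorem fox_word_odd (m : ℕ) : fox 0 (word (2 * m + 1)) =
    -((∑ i ∈ Finset.range m, of ℤ _ (fb * fa⁻¹) ^ i) * of ℤ _ (fb * fa⁻¹)) +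
      of ℤ _ (fb * fa⁻¹) ^ m * (of ℤ _ fb + of ℤ _ fb * of ℤ _ fa *
        ((∑ i ∈ Finset.range m, of ℤ _ (fb⁻¹ * fa) ^ i) * of ℤ _ fb⁻¹)) := by
  rw [word_odd, mul_assoc, fox_mul, fox_mul, fox_pow, fox_pow, fox_c, fox_d, mul_neg, map_pow,
    fox_mul 0 fb, fox_fb, fox_fa, mul_one, zero_add, map_mul _ fb fa]

end Fox

section Rep

variable {k : ℕ} {n : ℤ} (ρ : KnotGroup k n →* SL(2, ℂ))

theorem Phi_c : Phi ρ (MonoidAlgebra.of ℤ _ (fb * fa⁻¹)) =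
    lc (Ad (ρ (proj k n fb) * (ρ (proj k n fa))⁻¹)) := by
  rw [Phi_of_abel_eq_one]
  · simp only [map_mul, map_inv]
  · rw [map_mul, map_mul, map_inv, map_inv, abel_fa, abel_fb, mul_inv_cancel]

theorem Phi_d : Phi ρ (MonoidAlgebra.of ℤ _ (fb⁻¹ * fa)) =
    lc (Ad ((ρ (proj k n fb))⁻¹ * ρ (proj k n fa))) := by
  rw [Phi_of_abel_eq_one]
  · simp only [map_mul, map_inv]
  · rw [map_mul, map_mul, map_inv, map_inv, abel_fa, abel_fb, inv_mul_cancel]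

theorem rho_word_even {m : ℕ} {n : ℤ} (ρ : KnotGroup (2 * m) n →* SL(2, ℂ)) :
    ρ (proj _ n (word (2 * m))) =
      (ρ (proj _ n fb) * (ρ (proj _ n fa))⁻¹) ^ m *
        ((ρ (proj _ n fb))⁻¹ * ρ (proj _ n fa)) ^ m := by
  rw [word_even]
  simp only [map_mul, map_inv, map_pow]

theorem rho_word_odd {m : ℕ} {n : ℤ} (ρ : KnotGroup (2 * m + 1) n →* SL(2, ℂ)) :
    ρ (proj _ n (word (2 * m + 1))) =
      (ρ (proj _ n fb) * (ρ (proj _ n fa))⁻¹) ^ m * (ρ (proj _ n fb) * ρ (proj _ n fa)) *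
        ((ρ (proj _ n fb))⁻¹ * ρ (proj _ n fa)) ^ m := by
  rw [word_odd]
  simp only [map_mul, map_inv, map_pow]

theorem Phi_word_even {m : ℕ} {n : ℤ} (ρ : KnotGroup (2 * m) n →* SL(2, ℂ)) :
    Phi ρ (MonoidAlgebra.of ℤ _ (word (2 * m))) = lc (Ad (ρ (proj _ n (word (2 * m))))) := by
  refine Phi_of_abel_eq_one _ _ ?_
  rw [word_even]
  simp only [map_mul, map_pow, map_inv, abel_fa, abel_fb, mul_inv_cancel, inv_mul_cancel, one_pow,
    mul_one]

theorem Phi_word_odd {m : ℕ} {n : ℤ} (ρ : KnotGroup (2 * m + 1) n →* SL(2, ℂ)) :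
    Phi ρ (MonoidAlgebra.of ℤ _ (word (2 * m + 1))) =
      (LaurentPolynomial.T 2 : ℂ[T;T⁻¹]) • lc (Ad (ρ (proj _ n (word (2 * m + 1))))) := by
  have h : abel (2 * m + 1) n (proj _ n (word (2 * m + 1))) = Multiplicative.ofAdd 2 := by
    rw [word_odd]
    simp only [map_mul, map_pow, map_inv, abel_fa, abel_fb, mul_inv_cancel, inv_mul_cancel,
      one_pow, mul_one, one_mul]
    rfl
  rw [Phi_of, h]
  rfl

theorem trace_c : (ρ (proj k n fb) * (ρ (proj k n fa))⁻¹).1.trace = trY ρ := by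
  rw [trY, ← trace_inv, mul_inv_rev, inv_inv, map_mul, map_inv, map_mul, map_inv]

theorem trace_d : ((ρ (proj k n fb))⁻¹ * ρ (proj k n fa)).1.trace = trY ρ := by
  rw [trY, Matrix.SpecialLinearGroup.coe_mul, Matrix.trace_mul_comm,
    ← Matrix.SpecialLinearGroup.coe_mul, map_mul, map_inv, map_mul, map_inv]

theorem rho_conj (N : ℕ) (ρ : KnotGroup k (N : ℤ) →* SL(2, ℂ)) :
    ρ (proj k N (word k)) ^ N * ρ (proj k N fa) = ρ (proj k N fb) * ρ (proj k N (word k)) ^ N := by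
  have h := congrArg ρ (proj_conj (k := k) (n := N))
  simp only [zpow_natCast, map_mul, map_inv, map_pow] at h
  rw [← h, inv_mul_cancel_right]

/-! ### Nonvanishing of the Chebyshev factors. -/

theorem not_commute_word (N : ℕ) {ρ : KnotGroup k (N : ℤ) →* SL(2, ℂ)} (hρ : IsNonabelian ρ) :
    ¬ Commute (ρ (proj k N (word k)) ^ N) (ρ (proj k N fa)) := by
  intro h
  have h1 := rho_conj N ρ
  rw [h.eq] at h1
  have h2 := mul_right_cancel h1
  exact hρ.not_commute (by rw [h2])

theorem chebS_trZ_ne_zero (N : ℕ) {ρ : KnotGroup k (N : ℤ) →* SL(2, ℂ)} (hρ : IsNonabelian ρ) :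
    chebS ((N : ℤ) - 1) (trZ ρ) ≠ 0 := fun h =>
  not_commute_word N hρ (commute_of_eq_smul_one (pow_eq_smul_one rfl h) _)

theorem chebS_trY_ne_zero_even (m N : ℕ) {ρ : KnotGroup (2 * m) (N : ℤ) →* SL(2, ℂ)}
    (hρ : IsNonabelian ρ) : chebS ((m : ℤ) - 1) (trY ρ) ≠ 0 := by
  intro h
  refine not_commute_word N hρ ((Commute.pow_left ?_ _))
  rw [rho_word_even]
  exact (commute_of_eq_smul_one (pow_eq_smul_one (trace_c ρ) h) _).mul_left
    (commute_of_eq_smul_one (pow_eq_smul_one (trace_d ρ) h) _)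

/-- If S_{m-1}(y) = 0, both m-th powers in w equal the same scalar s with s² = 1, so w = ba and y +
z = (tr a)² = 4. The relation then reduces to S_{n-1}(z) = S_{n-2}(z). This gives Re z ≤ 2 while Re
y < 2, a contradiction. -/
theorem chebS_trY_ne_zero_odd (m N : ℕ) (hm : 1 ≤ m) (hN : 1 ≤ N)
    {ρ : KnotGroup (2 * m + 1) (N : ℤ) →* SL(2, ℂ)}
    (hρ : IsParabolic ρ) : chebS ((m : ℤ) - 1) (trY ρ) ≠ 0 := by
  intro h
  obtain ⟨M, rfl⟩ : ∃ M, N = M + 1 := ⟨N - 1, by omega⟩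
  have hc := pow_eq_smul_one (trace_c ρ) h
  have hd := pow_eq_smul_one (trace_d ρ) h
  set s := -chebS ((m : ℤ) - 2) (trY ρ)
  set A := ρ (proj _ _ fa) with hA
  set B := ρ (proj _ _ fb) with hB
  have hs : s * s = 1 := by
    have := ((B * A⁻¹) ^ m).2
    rw [hc, Matrix.det_smul, Matrix.det_one, Fintype.card_fin, mul_one, sq] at this
    exact this
  have hw : ρ (proj _ _ (word (2 * m + 1))) = B * A := by
    apply Subtype.ext
    rw [rho_word_odd, Matrix.SpecialLinearGroup.coe_mul, Matrix.SpecialLinearGroup.coe_mul,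
      hc, hd, Matrix.smul_mul, one_mul, Matrix.smul_mul, Matrix.mul_smul, mul_one, smul_smul, hs,
      one_smul]
  have hz : (B * A).1.trace = trZ ρ := by rw [trZ, hw]
  have htA : A.1.trace ^ 2 = 4 := hρ.trace_sq
  have htB : B.1.trace = A.1.trace := trace_fb ρ
  have hzy : trY ρ + trZ ρ = 4 := by
    rw [← trace_c ρ, ← hz, ← htA, ← hA, ← hB]
    have hinv : ((A⁻¹ : SL(2, ℂ)) : Matrix (Fin 2) (Fin 2) ℂ) = A.1.trace • 1 - A.1 := by
      rw [Matrix.SpecialLinearGroup.SL2_inv_expl, Matrix.trace_fin_two]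
      ext i j
      fin_cases i <;> fin_cases j <;> simp
    rw [Matrix.SpecialLinearGroup.coe_mul, hinv, mul_sub, Matrix.mul_smul, mul_one,
      Matrix.SpecialLinearGroup.coe_mul, Matrix.trace_sub, Matrix.trace_smul, htB, smul_eq_mul]
    ring
  have hrel := congrArg Subtype.val (rho_conj _ ρ)
  rw [hw, Matrix.SpecialLinearGroup.coe_mul, Matrix.SpecialLinearGroup.coe_mul,
    Matrix.SpecialLinearGroup.coe_pow, pow_eq_chebyshev _ (B * A).2, hz] at hrel
  change (chebS _ _ • _ - chebS _ _ • 1) * A.1 = B.1 * (chebS _ _ • _ - chebS _ _ • 1) at hrel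
  -- By Cayley–Hamilton with equal traces. It turns the relation, once wⁿ is expanded in w = ba,
  -- into a scalar multiple of A - B.
  have hcomm : B.1 * A.1 * A.1 - B.1 * (B.1 * A.1) = A.1 - B.1 := by
    rw [mul_assoc, mul_self_of_det_eq_one _ A.2, ← mul_assoc, mul_self_of_det_eq_one _ B.2, htB,
      mul_sub, sub_mul, Matrix.mul_smul, Matrix.smul_mul, mul_one, one_mul]
    abel
  have hdiff : (chebS (((M + 1 : ℕ) : ℤ) - 1) (trZ ρ) - chebS (((M + 1 : ℕ) : ℤ) - 2) (trZ ρ)) •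
      (A.1 - B.1) = 0 := by
    rw [sub_smul]
    nth_rw 1 [← hcomm]
    rw [Matrix.SpecialLinearGroup.coe_mul, sub_mul, mul_sub, Matrix.smul_mul, Matrix.smul_mul,
      Matrix.mul_smul, Matrix.mul_smul, one_mul, mul_one] at hrel
    rw [smul_sub, smul_sub]
    rw [sub_sub_sub_comm, hrel, sub_self]
  rcases smul_eq_zero.1 hdiff with h1 | h1
  · push_cast at h1
    rw [add_sub_cancel_right, show (M : ℤ) + 1 - 2 = M - 1 by ring, sub_eq_zero] at h1
    have h2 := re_le_two_of_chebS_eq h1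
    have h3 := re_lt_two_of_chebS_eq_zero hm h
    have h4 := congrArg Complex.re hzy
    rw [Complex.add_re, Complex.re_ofNat] at h4
    linarith
  · exact hρ.1.not_commute (by rw [← hA, ← hB, show A = B from Subtype.ext (sub_eq_zero.1 h1)])

end Rep

/-! ### Parabolic representations -/

theorem hasTop_pc (L : Matrix (Fin 3) (Fin 3) ℂ) : HasTop (pc L) 0 L := hasTop_const L

theorem hasTop_X_pow_smul_pc (d : ℕ) (L : Matrix (Fin 3) (Fin 3) ℂ) :
    HasTop ((Polynomial.X ^ d : Polynomial ℂ) • pc L) d L := hasTop_X_pow_smul d L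

theorem hasTop_X_smul_pc (L : Matrix (Fin 3) (Fin 3) ℂ) :
    HasTop ((Polynomial.X : Polynomial ℂ) • pc L) 1 L := hasTop_X_smul L

theorem hasTop_one_sub (L : Matrix (Fin 3) (Fin 3) ℂ) :
    HasTop (1 - (Polynomial.X : Polynomial ℂ) • pc L) 1 (-L) := by
  have h := ((hasTop_pc 1).of_lt Nat.zero_lt_one).sub (hasTop_X_smul_pc L)
  rwa [map_one, zero_sub] at h

/-- The matrix `∑_{i < N} X^{2i} W^i`. -/
def sumSq (W : Matrix (Fin 3) (Fin 3) ℂ) (N : ℕ) : Matrix (Fin 3) (Fin 3) (Polynomial ℂ) :=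
  ∑ i ∈ Finset.range N, (Polynomial.X ^ (2 * i) : Polynomial ℂ) • pc (W ^ i)

theorem sumSq_succ (W : Matrix (Fin 3) (Fin 3) ℂ) (N : ℕ) :
    sumSq W (N + 1) = sumSq W N + (Polynomial.X ^ (2 * N) : Polynomial ℂ) • pc (W ^ N) :=
  Finset.sum_range_succ _ _

theorem hasTop_sumSq (W : Matrix (Fin 3) (Fin 3) ℂ) (N : ℕ) :
    HasTop (sumSq W (N + 1)) (2 * N) (W ^ N) := by
  induction N with
  | zero => simpa [sumSq] using hasTop_pc 1
  | succ N ih =>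
    rw [sumSq_succ]
    have h := (ih.of_lt (e := 2 * (N + 1)) (by omega)).add
      (hasTop_X_pow_smul_pc (2 * (N + 1)) (W ^ (N + 1)))
    rwa [zero_add] at h

theorem pev_sumSq (W : Matrix (Fin 3) (Fin 3) ℂ) (N : ℕ) : pev 0 (sumSq W (N + 1)) = 1 := by
  induction N with
  | zero => simp [sumSq]
  | succ N ih => rw [sumSq_succ, map_add, ih, pev_smul, Polynomial.eval_pow, Polynomial.eval_X,
      zero_pow (by omega), zero_smul, add_zero]

theorem pl_sumSq (W : Matrix (Fin 3) (Fin 3) ℂ) (N : ℕ) :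
    pl (sumSq W N) = ∑ i ∈ Finset.range N, ((LaurentPolynomial.T 2 : ℂ[T;T⁻¹]) • lc W) ^ i := by
  rw [sumSq, map_sum]
  refine Finset.sum_congr rfl fun i _ => ?_
  rw [pl_smul, pl_pc, Polynomial.toLaurent_X_pow, smul_pow, LaurentPolynomial.T_pow, map_pow]
  congr 2
  push_cast
  ring

theorem det_Ad_pow (V : SL(2, ℂ)) (n : ℕ) : (Ad V ^ n).det = 1 := by
  rw [← map_pow, Ad_det]

/-! ### Top and bottom coefficient matrices in the three families. -/

theorem Phi_fox_word_even {m : ℕ} {n : ℤ} (ρ : KnotGroup (2 * m) n →* SL(2, ℂ)) :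
    Phi ρ (fox 0 (word (2 * m))) =
      -((∑ i ∈ Finset.range m, lc (Ad (ρ (proj _ n fb) * (ρ (proj _ n fa))⁻¹)) ^ i) *
        lc (Ad (ρ (proj _ n fb) * (ρ (proj _ n fa))⁻¹))) +
      lc (Ad (ρ (proj _ n fb) * (ρ (proj _ n fa))⁻¹)) ^ m *
        ((∑ i ∈ Finset.range m, lc (Ad ((ρ (proj _ n fb))⁻¹ * ρ (proj _ n fa))) ^ i) *
          ((LaurentPolynomial.T (-1) : ℂ[T;T⁻¹]) • lc (Ad (ρ (proj _ n fb))⁻¹))) := by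
  rw [fox_word_even]
  simp only [map_add (Phi ρ), map_mul (Phi ρ), map_neg (Phi ρ), map_sum (Phi ρ), map_pow (Phi ρ),
    Phi_c, Phi_d, Phi_fb_inv]

theorem Phi_fox_word_odd {m : ℕ} {n : ℤ} (ρ : KnotGroup (2 * m + 1) n →* SL(2, ℂ)) :
    Phi ρ (fox 0 (word (2 * m + 1))) =
      -((∑ i ∈ Finset.range m, lc (Ad (ρ (proj _ n fb) * (ρ (proj _ n fa))⁻¹)) ^ i) *
        lc (Ad (ρ (proj _ n fb) * (ρ (proj _ n fa))⁻¹))) +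
      lc (Ad (ρ (proj _ n fb) * (ρ (proj _ n fa))⁻¹)) ^ m *
        ((LaurentPolynomial.T 1 : ℂ[T;T⁻¹]) • (lc (Ad (ρ (proj _ n fb))) +
          lc (Ad (ρ (proj _ n fb))) * lc (Ad (ρ (proj _ n fa))) *
          ((∑ i ∈ Finset.range m, lc (Ad ((ρ (proj _ n fb))⁻¹ * ρ (proj _ n fa))) ^ i) *
            lc (Ad (ρ (proj _ n fb))⁻¹)))) := by
  have hT : (LaurentPolynomial.T (-1) * (LaurentPolynomial.T 1 * LaurentPolynomial.T 1) :
      ℂ[T;T⁻¹]) = LaurentPolynomial.T 1 := by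
    rw [← LaurentPolynomial.T_add, ← LaurentPolynomial.T_add]
    rfl
  rw [fox_word_odd]
  simp only [map_add (Phi ρ), map_mul (Phi ρ), map_neg (Phi ρ), map_sum (Phi ρ), map_pow (Phi ρ),
    Phi_c, Phi_d, Phi_fa, Phi_fb, Phi_fb_inv, Matrix.smul_mul, Matrix.mul_smul, smul_smul, hT,
    smul_add]

/-- The letter b⁻¹ in ∂w/∂a costs a factor t⁻¹. After it is split off, P has degree 2; the summand
Wⁿ sits in degree 1 and affects neither end. -/
theorem extremeTerms_even (m N : ℕ) (hm : 1 ≤ m) (hN : 1 ≤ N)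
    (ρ : KnotGroup (2 * m) (N : ℤ) →* SL(2, ℂ)) (hρ : IsParabolic ρ) :
    HasExtremeTerms (adjointAlexander ρ)
      0 (-((m : ℂ) * (N : ℂ) * chebS ((m : ℤ) - 1) (trY ρ) ^ 2 *
        chebS ((N : ℤ) - 1) (trZ ρ) ^ 2))
      (-3) ((m : ℂ) * (N : ℂ) * chebS ((m : ℤ) - 1) (trY ρ) ^ 2 *
        chebS ((N : ℤ) - 1) (trZ ρ) ^ 2) := by
  have hy := chebS_trY_ne_zero_even m N hρ.1
  have hz := chebS_trZ_ne_zero N hρ.1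
  have hm0 : (m : ℂ) ≠ 0 := Nat.cast_ne_zero.2 (by omega)
  have hN0 : (N : ℂ) ≠ 0 := Nat.cast_ne_zero.2 (by omega)
  set a := ρ (proj _ _ fa) with ha
  set b := ρ (proj _ _ fb) with hb
  set w := ρ (proj _ _ (word (2 * m))) with hw
  set B := Ad b
  set C := Ad (b * a⁻¹)
  set D := Ad (b⁻¹ * a)
  set W := Ad w
  let x : Polynomial ℂ := Polynomial.X
  let SW := ∑ i ∈ Finset.range N, W ^ i
  let SC := ∑ i ∈ Finset.range m, C ^ i
  let SD := ∑ i ∈ Finset.range m, D ^ i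
  have hSW : SW.det = N * chebS ((N : ℤ) - 1) (trZ ρ) ^ 2 := det_sum_Ad_pow _ _
  have hSC : SC.det = m * chebS ((m : ℤ) - 1) (trY ρ) ^ 2 := by
    rw [← trace_c ρ]; exact det_sum_Ad_pow _ _
  have hSD : SD.det = m * chebS ((m : ℤ) - 1) (trY ρ) ^ 2 := by
    rw [← trace_d ρ]; exact det_sum_Ad_pow _ _
  let P := x • pc (W ^ N) +
    (1 - x • pc B) * pc SW * (-(x • pc (SC * C)) + pc (C ^ m * (SD * Ad b⁻¹)))
  have hP : Phi ρ (fox 0 (relator (2 * m) N)) =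
      (LaurentPolynomial.T (-1) : ℂ[T;T⁻¹]) • pl P := by
    have hT : (LaurentPolynomial.T (-1) * LaurentPolynomial.T 1 : ℂ[T;T⁻¹]) = 1 := by
      rw [← LaurentPolynomial.T_add, neg_add_cancel, LaurentPolynomial.T_zero]
    rw [Phi_fox_relator, Phi_fox_word_even, Phi_word_even, Phi_fb]
    simp only [map_add pl, map_mul pl, map_neg pl, map_sub pl, map_one pl, pl_X_smul, pl_pc,
      P, SW, SC, SD, x, map_mul lc, map_sum lc, map_pow lc]
    rw [smul_add, smul_smul, hT, one_smul, ← Matrix.mul_smul, smul_add, smul_neg, smul_smul, hT,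
      one_smul, Matrix.mul_smul, Matrix.mul_smul]
  have hL : HasTop P 2 (0 + -B * SW * (-(SC * C) + 0)) :=
    ((hasTop_X_smul_pc _).of_lt (by norm_num)).add (((hasTop_one_sub B).mul (hasTop_pc SW)).mul
      ((hasTop_X_smul_pc _).neg.add ((hasTop_pc _).of_lt Nat.zero_lt_one)))
  have hdL : (0 + -B * SW * (-(SC * C) + 0)).det =
      m * N * chebS ((m : ℤ) - 1) (trY ρ) ^ 2 * chebS ((N : ℤ) - 1) (trZ ρ) ^ 2 := by
    rw [zero_add, add_zero, neg_mul, neg_mul_neg, Matrix.det_mul, Matrix.det_mul, Matrix.det_mul,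
      hSW, hSC, Ad_det, Ad_det]
    ring
  have hL₀ : pev 0 P = SW * (C ^ m * (SD * Ad b⁻¹)) := by
    simp only [P, map_add, map_mul, map_sub, map_neg, map_one, pev_smul, pev_pc, x,
      Polynomial.eval_X, zero_smul, sub_zero, neg_zero, zero_add, one_mul]
  have hdL₀ : (SW * (C ^ m * (SD * Ad b⁻¹))).det =
      m * N * chebS ((m : ℤ) - 1) (trY ρ) ^ 2 * chebS ((N : ℤ) - 1) (trZ ρ) ^ 2 := by
    rw [Matrix.det_mul, Matrix.det_mul, Matrix.det_mul, hSW, hSD, Ad_det, det_Ad_pow]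
    ring
  have h0 : (m * N * chebS ((m : ℤ) - 1) (trY ρ) ^ 2 *
      chebS ((N : ℤ) - 1) (trZ ρ) ^ 2 : ℂ) ≠ 0 :=
    mul_ne_zero (mul_ne_zero (mul_ne_zero hm0 hN0) (pow_ne_zero _ hy)) (pow_ne_zero _ hz)
  have := hasExtremeTerms_adjointAlexander ρ hρ (-1) P one_le_two hP hL hL₀
    (by rw [hdL]; exact h0) (by rw [hdL₀]; exact h0)
  rwa [hdL, hdL₀] at this

/-- Here Φ(w) = t²W, so P(0) only sees the i = 0 term of the sum over powers of w and the part of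
∂w/∂a of degree 0. The top degree 2n receives Wⁿ and one further product, which combine by the group
relation. -/
theorem extremeTerms_odd (m N : ℕ) (hm : 1 ≤ m) (hN : 1 ≤ N)
    (ρ : KnotGroup (2 * m + 1) (N : ℤ) →* SL(2, ℂ)) (hρ : IsParabolic ρ) :
    HasExtremeTerms (adjointAlexander ρ)
      (6 * N - 3) ((m : ℂ) * chebS ((m : ℤ) - 1) (trY ρ) ^ 2)
      0 (-((m : ℂ) * chebS ((m : ℤ) - 1) (trY ρ) ^ 2)) := by
  have hy := chebS_trY_ne_zero_odd m N hm hN hρ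
  have hm0 : (m : ℂ) ≠ 0 := Nat.cast_ne_zero.2 (by omega)
  obtain ⟨M, rfl⟩ : ∃ M, N = M + 1 := ⟨N - 1, by omega⟩
  have hrel := rho_conj _ ρ
  have hword := rho_word_odd ρ
  set a := ρ (proj _ _ fa) with ha
  set b := ρ (proj _ _ fb) with hb
  set w := ρ (proj _ _ (word (2 * m + 1))) with hw
  set A := Ad a with hA
  set B := Ad b with hB
  set C := Ad (b * a⁻¹) with hC
  set D := Ad (b⁻¹ * a) with hD
  set C' := Ad (a * b⁻¹) with hC'
  set W := Ad w with hW
  let x : Polynomial ℂ := Polynomial.X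
  let SC := ∑ i ∈ Finset.range m, C ^ i
  let SD := ∑ i ∈ Finset.range m, D ^ i
  let SC' := ∑ i ∈ Finset.range m, C' ^ i
  have hSC : SC.det = m * chebS ((m : ℤ) - 1) (trY ρ) ^ 2 := by
    rw [← trace_c ρ]; exact det_sum_Ad_pow _ _
  have hSC' : SC'.det = m * chebS ((m : ℤ) - 1) (trY ρ) ^ 2 := by
    rw [trY, map_mul, map_mul, map_inv, map_inv]; exact det_sum_Ad_pow _ _
  let P := x ^ (2 * (M + 1)) • pc (W ^ (M + 1)) +
    (1 - x • pc B) * sumSq W (M + 1) *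
      (-pc (SC * C) + x • pc (C ^ m * (B + B * A * (SD * Ad b⁻¹))))
  have hP : Phi ρ (fox 0 (relator (2 * m + 1) (M + 1 : ℕ))) =
      (LaurentPolynomial.T 0 : ℂ[T;T⁻¹]) • pl P := by
    have hT2 : (LaurentPolynomial.T 2 ^ (M + 1) : ℂ[T;T⁻¹]) =
        LaurentPolynomial.T ((2 * (M + 1) : ℕ) : ℤ) := by
      rw [LaurentPolynomial.T_pow]
      congr 1
      push_cast
      ring
    rw [LaurentPolynomial.T_zero, one_smul, Phi_fox_relator, Phi_fox_word_odd, Phi_word_odd, Phi_fb,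
      smul_pow, hT2]
    simp only [map_add pl, map_mul pl, map_neg pl, map_sub pl, map_one pl, pl_smul, pl_pc,
      Polynomial.toLaurent_X_pow, Polynomial.toLaurent_X, pl_sumSq, P, SC, SD, x, map_mul lc,
      map_add lc, map_sum lc, map_pow lc]
    rw [Matrix.mul_smul]
  have hL : HasTop P (2 * (M + 1)) (W ^ (M + 1) +
      -B * W ^ M * (0 + C ^ m * (B + B * A * (SD * Ad b⁻¹)))) := by
    have h1 := ((hasTop_one_sub B).mul (hasTop_sumSq W M)).mul
      (((hasTop_pc (SC * C)).neg.of_lt Nat.zero_lt_one).add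
        (hasTop_X_smul_pc (C ^ m * (B + B * A * (SD * Ad b⁻¹)))))
    rw [show 1 + 2 * M + 1 = 2 * (M + 1) by ring] at h1
    exact (hasTop_X_pow_smul_pc _ _).add h1
  -- With c' = ab⁻¹ the relation gives wⁿ = b wⁿ⁻¹ (ba⁻¹)^m b c'^m, so Wⁿ is exactly the surplus
  -- term C'^m left by the telescoping identity 1 + ∑_{i<m} C'^{i+1} = ∑_{i<m} C'^i + C'^m.
  have hLeq : W ^ (M + 1) + -B * W ^ M * (0 + C ^ m * (B + B * A * (SD * Ad b⁻¹))) =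
      -(B * W ^ M * C ^ m * B * SC') := by
    have hsum : SC' * C' + 1 = SC' + C' ^ m := by
      simp only [SC', Finset.sum_mul, ← pow_succ]
      rw [← Finset.sum_range_succ, Finset.sum_range_succ']
      simp
    have hAD : A * (SD * Ad b⁻¹) = SC' * C' := by
      simp only [SC', SD, Finset.sum_mul, Finset.mul_sum]
      refine Finset.sum_congr rfl fun i _ => ?_
      rw [hA, hD, hC', ← map_pow, ← map_pow, ← map_mul, ← map_mul, ← map_mul]
      congr 1
      have : a * (b⁻¹ * a) ^ i = (a * b⁻¹) ^ i * a := by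
        have h := (SemiconjBy.pow_right (a := a) (x := b⁻¹ * a) (y := a * b⁻¹)
          (by rw [SemiconjBy, mul_assoc]) i).eq
        exact h
      rw [← mul_assoc, this, mul_assoc]
    have hWM : W ^ (M + 1) = B * W ^ M * C ^ m * B * C' ^ m := by
      have hw' : w = (b * a⁻¹) ^ m * b * (a * b⁻¹) ^ m * a := by
        have h := (SemiconjBy.pow_right (a := a) (x := b⁻¹ * a) (y := a * b⁻¹)
          (by rw [SemiconjBy, mul_assoc]) m).eq
        rw [hword, mul_assoc _ (b * a), mul_assoc b, h]
        simp only [mul_assoc]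
      have h2 : w ^ (M + 1) = b * w ^ M * (b * a⁻¹) ^ m * b * (a * b⁻¹) ^ m := by
        have h3 : w ^ (M + 1) * a = (b * w ^ M * (b * a⁻¹) ^ m * b * (a * b⁻¹) ^ m) * a := by
          rw [hrel, pow_succ]
          nth_rw 2 [hw']
          simp only [mul_assoc]
        exact mul_right_cancel h3
      rw [hW, ← map_pow, h2]
      simp only [map_mul, map_pow, hB, hC, hC']
    rw [zero_add, mul_assoc B A, hAD, hWM, ← mul_one_add, add_comm 1, hsum, mul_add]
    noncomm_ring
  have hdL : (W ^ (M + 1) + -B * W ^ M * (0 + C ^ m * (B + B * A * (SD * Ad b⁻¹)))).det =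
      -(m * chebS ((m : ℤ) - 1) (trY ρ) ^ 2) := by
    rw [hLeq, Matrix.det_neg, Fintype.card_fin, Matrix.det_mul, Matrix.det_mul, Matrix.det_mul,
      Matrix.det_mul, hSC', det_Ad_pow, det_Ad_pow, Ad_det]
    ring
  have hL₀ : pev 0 P = -(SC * C) := by
    simp only [P, map_add, map_mul, map_sub, map_neg, map_one, pev_smul, pev_pc, pev_sumSq, x,
      Polynomial.eval_X, Polynomial.eval_pow, zero_smul, sub_zero, add_zero, one_mul]
    rw [zero_pow (by omega), zero_smul, zero_add]
  have hdL₀ : (-(SC * C)).det = -(m * chebS ((m : ℤ) - 1) (trY ρ) ^ 2) := by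
    rw [Matrix.det_neg, Fintype.card_fin, Matrix.det_mul, hSC, Ad_det]
    ring
  have h0 : (-(m * chebS ((m : ℤ) - 1) (trY ρ) ^ 2) : ℂ) ≠ 0 :=
    neg_ne_zero.2 (mul_ne_zero hm0 (pow_ne_zero _ hy))
  have := hasExtremeTerms_adjointAlexander ρ hρ 0 P (by omega) hP hL hL₀
    (by rw [hdL]; exact h0) (by rw [hdL₀]; exact h0)
  rw [hdL, hdL₀, neg_neg] at this
  convert this using 1
  · push_cast
    ring
  · norm_num

/-- Now w = ba and ∂w/∂a = b, and the terms of degree 2n cancel because wⁿ = b wⁿ⁻¹ b. What remains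
is t times a polynomial matrix of degree 2n - 2, whose extreme coefficients are products of adjoint
matrices. -/
theorem extremeTerms_one (N : ℕ) (hN : 2 ≤ N)
    (ρ : KnotGroup 1 (N : ℤ) →* SL(2, ℂ)) (hρ : IsParabolic ρ) :
    HasExtremeTerms (adjointAlexander ρ) (6 * N - 6) (-1) 3 1 := by
  obtain ⟨M, rfl⟩ : ∃ M, N = M + 2 := ⟨N - 2, by omega⟩
  have hrel := rho_conj _ ρ
  have hw' := rho_word_odd (m := 0) ρ
  rw [pow_zero, one_mul, pow_zero, mul_one] at hw'
  change ρ (proj _ _ (word 1)) = _ at hw'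
  set a := ρ (proj _ _ fa) with ha
  set b := ρ (proj _ _ fb) with hb
  set w := ρ (proj _ _ (word 1)) with hw
  set B := Ad b with hB
  set W := Ad w with hW
  let x : Polynomial ℂ := Polynomial.X
  let P := sumSq W (M + 2) * pc B - x • pc B * sumSq W (M + 1) * pc B
  have hWM : W ^ (M + 2) = B * W ^ (M + 1) * B := by
    have h2 : w ^ (M + 2) = b * w ^ (M + 1) * b := by
      have h3 : w ^ (M + 2) * a = (b * w ^ (M + 1) * b) * a := by
        rw [hrel, pow_succ, mul_assoc _ b a, ← hw', mul_assoc]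
      exact mul_right_cancel h3
    rw [hW, ← map_pow, h2]
    simp only [map_mul, map_pow, hB]
  have hP : Phi ρ (fox 0 (relator 1 (M + 2 : ℕ))) =
      (LaurentPolynomial.T 1 : ℂ[T;T⁻¹]) • pl P := by
    have hfox : Phi ρ (fox 0 (word 1)) = (LaurentPolynomial.T 1 : ℂ[T;T⁻¹]) • lc B := by
      have h := Phi_fox_word_odd (m := 0) ρ
      rwa [Finset.range_zero, Finset.sum_empty, Finset.sum_empty, zero_mul, zero_mul,
        mul_zero (_ * _ : Matrix (Fin 3) (Fin 3) ℂ[T;T⁻¹]), neg_zero, zero_add, pow_zero,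
        one_mul, add_zero] at h
    have hword' : Phi ρ (MonoidAlgebra.of ℤ _ (word 1)) =
      (LaurentPolynomial.T 2 : ℂ[T;T⁻¹]) • lc W := Phi_word_odd (m := 0) ρ
    have hT : (LaurentPolynomial.T 2 ^ (M + 2) : ℂ[T;T⁻¹]) =
        LaurentPolynomial.T 1 * LaurentPolynomial.T 1 *
          Polynomial.toLaurent (Polynomial.X ^ (2 * (M + 1))) := by
      rw [LaurentPolynomial.T_pow, Polynomial.toLaurent_X_pow, ← LaurentPolynomial.T_add,
        ← LaurentPolynomial.T_add]
      congr 1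
      push_cast
      ring
    have hsum : pl (sumSq W (M + 2)) = pl (sumSq W (M + 1)) +
        Polynomial.toLaurent (Polynomial.X ^ (2 * (M + 1)) : Polynomial ℂ) •
          lc (W ^ (M + 1)) := by
      rw [sumSq_succ, map_add, pl_smul, pl_pc]
    rw [Phi_fox_relator, hfox, hword', Phi_fb, ← pl_sumSq, smul_pow, ← map_pow, hWM, hT]
    simp only [map_mul pl, map_sub pl, pl_smul, pl_pc, P, x, map_mul lc, Polynomial.toLaurent_X,
      hsum, sub_mul, one_mul, mul_add, add_mul, smul_add, smul_sub, Matrix.smul_mul,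
      Matrix.mul_smul, smul_smul]
    module
  have hL : HasTop P (2 * (M + 1)) (W ^ (M + 1) * B - 0) := by
    refine ((hasTop_sumSq W (M + 1)).mul (hasTop_pc B)).sub ?_
    exact ((((hasTop_X_smul_pc B).mul (hasTop_sumSq W M)).mul (hasTop_pc B)).of_lt (by omega))
  have hdL : (W ^ (M + 1) * B - 0).det = 1 := by
    rw [sub_zero, Matrix.det_mul, det_Ad_pow, Ad_det, one_mul]
  have hL₀ : pev 0 P = B := by
    simp only [P, map_mul, map_sub, pev_smul, pev_pc, pev_sumSq, x,
      Polynomial.eval_X, zero_smul, sub_zero, zero_mul, one_mul]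
  have := hasExtremeTerms_adjointAlexander ρ hρ 1 P (by omega) hP hL hL₀
    (by rw [hdL]; exact one_ne_zero) (by rw [Ad_det]; exact one_ne_zero)
  rw [hdL, Ad_det] at this
  convert this using 1
  · push_cast
    ring
  · norm_num

/-! ### Elements commuting with the meridian -/

section Group

variable {G : Type*} [Group G] (a b : G) (m N : ℕ)

theorem conj_pow_right : a * (b⁻¹ * a) ^ m = ((b * a⁻¹) ^ m)⁻¹ * a := by
  have h := (SemiconjBy.pow_right (a := a) (x := b⁻¹ * a) (y := (b * a⁻¹)⁻¹)
    (by rw [SemiconjBy]; group) m).eq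
  rw [h, inv_pow]

theorem conj_pow_right' : b * (b⁻¹ * a) ^ m = ((b * a⁻¹) ^ m)⁻¹ * b := by
  have h := (SemiconjBy.pow_right (a := b) (x := b⁻¹ * a) (y := (b * a⁻¹)⁻¹)
    (by rw [SemiconjBy]; group) m).eq
  rw [h, inv_pow]

/-- The element is a longitude: wⁿ preceded by its reversed word, since w read backwards equals c⁻¹
w⁻¹ c with c = (ba⁻¹)^m. The factor wⁿ conjugates a to b, and the reversed factor conjugates b back
to a. -/
theorem reverse_even {w : G} (hw : w = (b * a⁻¹) ^ m * (b⁻¹ * a) ^ m)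
    (h : w ^ N * a = b * w ^ N) :
    Commute (((b * a⁻¹) ^ m)⁻¹ * (w ^ N)⁻¹ * (b * a⁻¹) ^ m * w ^ N) a := by
  have h1 := conj_pow_right a b m
  have h2 := conj_pow_right' a b m
  set c := (b * a⁻¹) ^ m
  set d := (b⁻¹ * a) ^ m
  have hcb : c * b = b * w⁻¹ * c := by
    rw [hw, mul_inv_rev, mul_assoc, mul_assoc, inv_mul_cancel, mul_one, eq_mul_inv_iff_mul_eq,
      mul_assoc, h2, mul_inv_cancel_left]
  have hca : c⁻¹ * a * w⁻¹ = a * c⁻¹ := by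
    rw [← h1, hw]; group
  have hWb : (w ^ N)⁻¹ * b = a * (w ^ N)⁻¹ := by
    rw [eq_mul_inv_iff_mul_eq, mul_assoc, ← h, inv_mul_cancel_left]
  have hcomm : (w ^ N)⁻¹ * w⁻¹ = w⁻¹ * (w ^ N)⁻¹ :=
    ((Commute.refl w).pow_left N).inv_inv.eq
  have key : c⁻¹ * (w ^ N)⁻¹ * c * b = a * (c⁻¹ * (w ^ N)⁻¹ * c) := by
    calc c⁻¹ * (w ^ N)⁻¹ * c * b = c⁻¹ * ((w ^ N)⁻¹ * b) * w⁻¹ * c := by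
          rw [mul_assoc _ c b, hcb]; simp only [mul_assoc]
      _ = c⁻¹ * a * ((w ^ N)⁻¹ * w⁻¹) * c := by rw [hWb]; simp only [mul_assoc]
      _ = (c⁻¹ * a * w⁻¹) * (w ^ N)⁻¹ * c := by rw [hcomm]; simp only [mul_assoc]
      _ = _ := by rw [hca]; simp only [mul_assoc]
  rw [Commute, SemiconjBy, mul_assoc, h, ← mul_assoc, key]
  simp only [mul_assoc]

theorem word_odd_eq {w : G} (hw : w = (b * a⁻¹) ^ m * (b * a) * (b⁻¹ * a) ^ m) :
    w = (b * a⁻¹) ^ m * b * ((b * a⁻¹) ^ m)⁻¹ * a := by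
  rw [hw, mul_assoc _ (b * a), mul_assoc b, conj_pow_right]
  simp only [mul_assoc]

/-- As in the even case, with w read backwards equal to c⁻¹ a w a⁻¹ c. -/
theorem reverse_odd {w : G} (hw : w = (b * a⁻¹) ^ m * (b * a) * (b⁻¹ * a) ^ m)
    (h : w ^ N * a = b * w ^ N) :
    Commute (((b * a⁻¹) ^ m)⁻¹ * a * w ^ N * a⁻¹ * (b * a⁻¹) ^ m * w ^ N) a := by
  have hw' := word_odd_eq a b m hw
  have hc1 : ((b * a⁻¹) ^ m)⁻¹ * (a * b⁻¹) = (a * b⁻¹) * ((b * a⁻¹) ^ m)⁻¹ := by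
    have := ((Commute.refl (b * a⁻¹)).pow_left m).inv_inv.eq
    rwa [mul_inv_rev, inv_inv] at this
  set c := (b * a⁻¹) ^ m
  have hcb : c * b = w * a⁻¹ * c := by rw [hw']; group
  have hWa : w ^ N * a⁻¹ = b⁻¹ * w ^ N := by
    rw [eq_inv_mul_iff_mul_eq, ← mul_assoc, ← h, mul_inv_cancel_right]
  have hcomm : w ^ N * w = w * w ^ N := ((Commute.refl w).pow_left N).eq
  have hca : c⁻¹ * (a * b⁻¹) * w = a * c⁻¹ * a := by
    rw [hc1, hw']; group
  have key : c⁻¹ * a * w ^ N * a⁻¹ * c * b = a * (c⁻¹ * a * w ^ N * a⁻¹ * c) := by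
    calc c⁻¹ * a * w ^ N * a⁻¹ * c * b = c⁻¹ * a * (w ^ N * a⁻¹) * w * a⁻¹ * c := by
          rw [mul_assoc _ c b, hcb]; simp only [mul_assoc]
      _ = c⁻¹ * (a * b⁻¹) * (w ^ N * w) * a⁻¹ * c := by rw [hWa]; simp only [mul_assoc]
      _ = (c⁻¹ * (a * b⁻¹) * w) * w ^ N * a⁻¹ * c := by rw [hcomm]; simp only [mul_assoc]
      _ = _ := by rw [hca]; simp only [mul_assoc]
  rw [Commute, SemiconjBy, mul_assoc, h, ← mul_assoc, key]
  simp only [mul_assoc]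

end Group

/-! ### The anti-automorphism of `SL₂` fixing the standard parabolic matrices -/

section Reverse

variable {K : Type*} [Field K]

/-- Reflection of a matrix in `SL₂` across the anti-diagonal. -/
def rev (V : SL(2, K)) : SL(2, K) :=
  ⟨!![V 1 1, V 0 1; V 1 0, V 0 0], by
    have := V.2
    rw [Matrix.det_fin_two] at this ⊢
    simp only [Matrix.of_apply, Matrix.cons_val', Matrix.cons_val_zero, Matrix.cons_val_one,
      Matrix.cons_val_fin_one]
    linear_combination this⟩

theorem rev_coe (V : SL(2, K)) :
    (rev V : Matrix (Fin 2) (Fin 2) K) = !![V 1 1, V 0 1; V 1 0, V 0 0] := rfl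

theorem rev_mul (V V' : SL(2, K)) : rev (V * V') = rev V' * rev V := by
  apply Subtype.ext
  rw [Matrix.SpecialLinearGroup.coe_mul, rev_coe, rev_coe, rev_coe,
    Matrix.SpecialLinearGroup.coe_mul]
  ext i j
  fin_cases i <;> fin_cases j <;>
    simp [Matrix.mul_apply, Fin.sum_univ_two] <;> ring

theorem rev_one : rev (1 : SL(2, K)) = 1 := by
  apply Subtype.ext
  ext i j
  fin_cases i <;> fin_cases j <;> simp [rev]

theorem rev_pow (V : SL(2, K)) (n : ℕ) : rev (V ^ n) = rev V ^ n := by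
  induction n with
  | zero => rw [pow_zero, pow_zero, rev_one]
  | succ n ih => rw [pow_succ, rev_mul, ih, pow_succ']

theorem rev_inv (V : SL(2, K)) : rev V⁻¹ = (rev V)⁻¹ := by
  rw [eq_inv_iff_mul_eq_one, ← rev_mul, mul_inv_cancel, rev_one]

/-- As `rev` fixes A and B and reverses products, `rev w` is the value of the reversed word. The
image of the longitude is thus rev(wⁿ) wⁿ, which depends on the matrix wⁿ alone. -/
theorem rev_word_even {A B w : SL(2, K)} (hA : rev A = A) (hB : rev B = B) (m : ℕ)
    (hw : w = (B * A⁻¹) ^ m * (B⁻¹ * A) ^ m) :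
    rev w = ((B * A⁻¹) ^ m)⁻¹ * w⁻¹ * (B * A⁻¹) ^ m := by
  rw [hw, rev_mul, rev_pow, rev_pow, rev_mul, rev_mul, rev_inv, rev_inv, hA, hB, mul_inv_rev,
    show A * B⁻¹ = (B * A⁻¹)⁻¹ by group, show A⁻¹ * B = (B⁻¹ * A)⁻¹ by group, inv_pow, inv_pow]
  group

theorem rev_word_odd {A B w : SL(2, K)} (hA : rev A = A) (hB : rev B = B) (m : ℕ)
    (hw : w = (B * A⁻¹) ^ m * (B * A) * (B⁻¹ * A) ^ m) :
    rev w = ((B * A⁻¹) ^ m)⁻¹ * A * w * A⁻¹ * (B * A⁻¹) ^ m := by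
  have h := conj_pow_right' A B m
  have h1 : (B * A⁻¹) ^ m * B = B * ((B⁻¹ * A) ^ m)⁻¹ := by
    rw [eq_mul_inv_iff_mul_eq, mul_assoc, h, mul_inv_cancel_left]
  have h2 : rev ((B * A⁻¹) ^ m) = ((B⁻¹ * A) ^ m)⁻¹ := by
    rw [rev_pow, rev_mul, rev_inv, hA, hB, ← inv_pow, mul_inv_rev, inv_inv]
  rw [word_odd_eq A B m hw, rev_mul, rev_mul, rev_mul, rev_inv, h2, hA, hB, inv_inv, ← mul_assoc,
    ← mul_assoc, conj_pow_right, mul_assoc _ B, ← h1]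
  group

end Reverse

/-! ### Growth of Chebyshev polynomials for an ultrametric norm -/

section Ultrametric

variable {K : Type*} [NormedField K] [IsUltrametricDist K]

open Polynomial

theorem norm_add_eq_left {x y : K} (h : ‖y‖ < ‖x‖) : ‖x + y‖ = ‖x‖ := by
  rw [IsUltrametricDist.norm_add_eq_max_of_norm_ne_norm h.ne', max_eq_left h.le]

theorem norm_sub_eq_left {x y : K} (h : ‖y‖ < ‖x‖) : ‖x - y‖ = ‖x‖ := by
  rw [sub_eq_add_neg, norm_add_eq_left (by rwa [norm_neg])]

/-- In the recursion the term v S_n strictly dominates S_{n-1}, so the ultrametric norm of the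
difference is that of v S_n. -/
theorem norm_S_lt {v : K} (hv : 1 < ‖v‖) (n : ℕ) :
    ‖(Chebyshev.S K ((n : ℤ) - 1)).eval v‖ < ‖(Chebyshev.S K (n : ℤ)).eval v‖ ∧
      1 ≤ ‖(Chebyshev.S K (n : ℤ)).eval v‖ := by
  induction n with
  | zero => simp
  | succ n ih =>
    obtain ⟨h1, h2⟩ := ih
    have h3 : ‖(Chebyshev.S K (n : ℤ)).eval v‖ < ‖v * (Chebyshev.S K (n : ℤ)).eval v‖ := by
      rw [norm_mul]
      exact lt_mul_of_one_lt_left (by linarith) hv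
    have h4 : ‖(Chebyshev.S K ((n : ℤ) + 1)).eval v‖ = ‖v * (Chebyshev.S K (n : ℤ)).eval v‖ := by
      rw [Chebyshev.S_add_one, eval_sub, eval_mul, eval_X, norm_sub_eq_left (h1.trans h3)]
    push_cast
    rw [add_sub_cancel_right, h4]
    exact ⟨h3, h2.trans h3.le⟩

theorem norm_S_le_one {v : K} (hv : ‖v‖ ≤ 1) (n : ℕ) :
    ‖(Chebyshev.S K ((n : ℤ) - 1)).eval v‖ ≤ 1 ∧ ‖(Chebyshev.S K (n : ℤ)).eval v‖ ≤ 1 := by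
  induction n with
  | zero => simp
  | succ n ih =>
    obtain ⟨h1, h2⟩ := ih
    push_cast
    rw [add_sub_cancel_right, Chebyshev.S_add_one, eval_sub, eval_mul, eval_X, sub_eq_add_neg]
    refine ⟨h2, (IsUltrametricDist.norm_add_le_max _ _).trans (max_le ?_ (by rwa [norm_neg]))⟩
    rw [norm_mul]
    exact mul_le_one₀ hv (norm_nonneg _) h2

/-- The alternative α = 1 serves k = 1, where the upper left entry of w is identically 1; the strict
growth of S then replaces the size of α, and this needs N ≥ 2. -/
theorem norm_riley {z α : K} {N : ℕ} (hN : 1 ≤ N) (hz : 1 < ‖z‖)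
    (hα : 1 < ‖α‖ ∨ α = 1 ∧ 2 ≤ N) :
    1 < ‖(Chebyshev.S K ((N : ℤ) - 1)).eval z * α - (Chebyshev.S K ((N : ℤ) - 2)).eval z‖ := by
  obtain ⟨M, rfl⟩ : ∃ M, N = M + 1 := ⟨N - 1, by omega⟩
  obtain ⟨h1, h2⟩ := norm_S_lt hz M
  push_cast
  rw [add_sub_cancel_right, show (M : ℤ) + 1 - 2 = M - 1 by ring]
  rcases hα with hα | ⟨rfl, hM⟩
  · have h3 : ‖(Chebyshev.S K (M : ℤ)).eval z‖ < ‖(Chebyshev.S K (M : ℤ)).eval z * α‖ := by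
      rw [norm_mul]
      exact lt_mul_of_one_lt_right (by linarith) hα
    rw [norm_sub_eq_left (h1.trans h3)]
    exact h2.trans_lt h3
  · rw [mul_one, norm_sub_eq_left h1]
    obtain ⟨L, rfl⟩ : ∃ L, M = L + 1 := ⟨M - 1, by omega⟩
    push_cast at h1 ⊢
    rw [add_sub_cancel_right] at h1
    exact (norm_S_lt hz L).2.trans_lt h1

/-- The polynomial P in u takes the value N - (N - 1) = 1 at 0 and has norm greater than 1 outside
the closed unit disc. Hence it is not constant, and its roots lie in the disc. -/
theorem exists_riley_root [IsAlgClosed K] (hK : ∃ t : K, 1 < ‖t‖) {Z Al : K[X]} {N : ℕ}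
    (hN : 1 ≤ N) (hZ : Z.eval 0 = 2) (hAl : Al.eval 0 = 1)
    (hgrow : ∀ u : K, 1 < ‖u‖ → 1 < ‖Z.eval u‖ ∧ (1 < ‖Al.eval u‖ ∨ Al.eval u = 1 ∧ 2 ≤ N)) :
    ∃ u : K, ‖u‖ ≤ 1 ∧ (Chebyshev.S K ((N : ℤ) - 1)).eval (Z.eval u) * Al.eval u -
      (Chebyshev.S K ((N : ℤ) - 2)).eval (Z.eval u) = 0 := by
  let P : K[X] := (Chebyshev.S K ((N : ℤ) - 1)).comp Z * Al - (Chebyshev.S K ((N : ℤ) - 2)).comp Z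
  have hP : ∀ u, P.eval u = (Chebyshev.S K ((N : ℤ) - 1)).eval (Z.eval u) * Al.eval u -
      (Chebyshev.S K ((N : ℤ) - 2)).eval (Z.eval u) := fun u => by simp [P, eval_comp]
  have hP0 : P.eval 0 = 1 := by
    rw [hP, hZ, hAl, Chebyshev.S_eval_two, Chebyshev.S_eval_two]
    push_cast
    ring
  have hbig : ∀ u, 1 < ‖u‖ → 1 < ‖P.eval u‖ := fun u hu => by
    rw [hP]
    exact norm_riley hN (hgrow u hu).1 (hgrow u hu).2
  have hdeg : P.degree ≠ 0 := by
    intro h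
    rw [eq_C_of_degree_eq_zero h] at hP0 hbig
    rw [eval_C] at hP0
    obtain ⟨t, ht⟩ := hK
    have := hbig t ht
    rw [eval_C, hP0, norm_one] at this
    exact lt_irrefl _ this
  obtain ⟨u, hu⟩ := IsAlgClosed.exists_root P hdeg
  refine ⟨u, ?_, (hP u).symm.trans hu⟩
  by_contra! h
  have := hbig u h
  rw [hu.eq_zero, norm_zero] at this
  linarith

end Ultrametric

/-! ### Parabolic representations over an ultrametric field -/

section Standard

variable {K : Type*} [Field K]

/-- The standard parabolic matrix `[[1, 1], [0, 1]]`. -/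
def parA (K : Type*) [Field K] : SL(2, K) := ⟨!![1, 1; 0, 1], by simp [Matrix.det_fin_two]⟩

/-- The parabolic matrix `[[1, 0], [-u, 1]]`. -/
def parB (u : K) : SL(2, K) := ⟨!![1, 0; -u, 1], by simp [Matrix.det_fin_two]⟩

theorem parA_coe : (parA K : Matrix (Fin 2) (Fin 2) K) = !![1, 1; 0, 1] := rfl

theorem parB_coe (u : K) : (parB u : Matrix (Fin 2) (Fin 2) K) = !![1, 0; -u, 1] := rfl

theorem rev_parA : rev (parA K) = parA K := Subtype.ext rfl

theorem rev_parB (u : K) : rev (parB u) = parB u := Subtype.ext rfl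

theorem inv_coe (V : SL(2, K)) : ((V⁻¹ : SL(2, K)) : Matrix (Fin 2) (Fin 2) K) =
    !![V 1 1, -V 0 1; -V 1 0, V 0 0] := by
  rw [Matrix.SpecialLinearGroup.SL2_inv_expl]
  rfl

theorem parC_coe (u : K) : (parB u * (parA K)⁻¹ : SL(2, K)).1 = !![1, -1; -u, 1 + u] := by
  rw [Matrix.SpecialLinearGroup.coe_mul, inv_coe, parA_coe, parB_coe]
  ext i j
  fin_cases i <;> fin_cases j <;> simp [Matrix.mul_apply, Fin.sum_univ_two, add_comm]

theorem parD_coe (u : K) : ((parB u)⁻¹ * parA K : SL(2, K)).1 = !![1, 1; u, 1 + u] := by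
  rw [Matrix.SpecialLinearGroup.coe_mul, inv_coe, parA_coe, parB_coe]
  ext i j
  fin_cases i <;> fin_cases j <;> simp [Matrix.mul_apply, Fin.sum_univ_two, add_comm]

/-- The value `S_{m-1}(2 + u)`. -/
def gS (m : ℕ) (u : K) : K := (Polynomial.Chebyshev.S K ((m : ℤ) - 1)).eval (2 + u)

/-- The value `S_m(2 + u) - S_{m-1}(2 + u)`. -/
def fS (m : ℕ) (u : K) : K := (Polynomial.Chebyshev.S K (m : ℤ)).eval (2 + u) - gS m u

theorem S_sub_two_eval (m : ℕ) (u : K) :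
    (Polynomial.Chebyshev.S K ((m : ℤ) - 2)).eval (2 + u) = gS m u - (fS m u - u * gS m u) := by
  have h := congrArg (Polynomial.eval (2 + u)) (Polynomial.Chebyshev.S_sub_two K (m : ℤ))
  rw [Polynomial.eval_sub, Polynomial.eval_mul, Polynomial.eval_X] at h
  rw [h, fS, gS]
  ring

theorem parC_pow (u : K) (m : ℕ) : ((parB u * (parA K)⁻¹) ^ m : SL(2, K)).1 =
    !![fS m u - u * gS m u, -gS m u; -u * gS m u, fS m u] := by
  have htr : (parB u * (parA K)⁻¹ : SL(2, K)).1.trace = 2 + u := by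
    rw [parC_coe, Matrix.trace_fin_two]; simp; ring
  rw [Matrix.SpecialLinearGroup.coe_pow, pow_eq_chebyshev _ (parB u * (parA K)⁻¹).2, htr,
    S_sub_two_eval, parC_coe, ← gS]
  ext i j
  fin_cases i <;> fin_cases j <;> simp <;> ring

theorem parD_pow (u : K) (m : ℕ) : (((parB u)⁻¹ * parA K) ^ m : SL(2, K)).1 =
    !![fS m u - u * gS m u, gS m u; u * gS m u, fS m u] := by
  have htr : ((parB u)⁻¹ * parA K : SL(2, K)).1.trace = 2 + u := by
    rw [parD_coe, Matrix.trace_fin_two]; simp; ring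
  rw [Matrix.SpecialLinearGroup.coe_pow, pow_eq_chebyshev _ ((parB u)⁻¹ * parA K).2, htr,
    S_sub_two_eval, parD_coe, ← gS]
  ext i j
  fin_cases i <;> fin_cases j <;> simp <;> ring

theorem fS_gS (u : K) (m : ℕ) : (fS m u - u * gS m u) * fS m u - u * gS m u ^ 2 = 1 := by
  have h := ((parB u * (parA K)⁻¹) ^ m : SL(2, K)).2
  rw [parC_pow, Matrix.det_fin_two] at h
  simp at h
  linear_combination h

/-- The image of `w` under the representation `a ↦ parA`, `b ↦ parB u`, for even `k`. -/
def parWEven (m : ℕ) (u : K) : SL(2, K) :=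
  (parB u * (parA K)⁻¹) ^ m * ((parB u)⁻¹ * parA K) ^ m

/-- The image of `w` under the representation `a ↦ parA`, `b ↦ parB u`, for odd `k`. -/
def parWOdd (m : ℕ) (u : K) : SL(2, K) :=
  (parB u * (parA K)⁻¹) ^ m * (parB u * parA K) * ((parB u)⁻¹ * parA K) ^ m

/-- The lower left entry is kept as -u times the upper right one; this is the symmetry that
`pow_coe_of_root` needs. -/
theorem parWEven_coe (m : ℕ) (u : K) : (parWEven m u).1 =
    !![1 - u * gS m u * (fS m u - u * gS m u), -(u * gS m u ^ 2);
      -u * -(u * gS m u ^ 2), fS m u ^ 2 - u * gS m u ^ 2] := by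
  have h := fS_gS u m
  rw [parWEven, Matrix.SpecialLinearGroup.coe_mul, parC_pow, parD_pow]
  ext i j
  fin_cases i <;> fin_cases j <;> simp [Matrix.mul_apply, Fin.sum_univ_two] <;>
    first | linear_combination h | ring

theorem parWOdd_coe (m : ℕ) (u : K) : (parWOdd m u).1 =
    !![1 + u * fS m u * gS m u, fS m u ^ 2;
      -u * fS m u ^ 2, 1 - u * fS m u ^ 2 - u * fS m u * gS m u] := by
  have h := fS_gS u m
  rw [parWOdd, Matrix.SpecialLinearGroup.coe_mul, Matrix.SpecialLinearGroup.coe_mul,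
    Matrix.SpecialLinearGroup.coe_mul, parC_pow, parD_pow, parA_coe, parB_coe]
  ext i j
  fin_cases i <;> fin_cases j <;> simp [Matrix.mul_apply, Fin.sum_univ_two]
  · linear_combination h
  · ring
  · ring
  · linear_combination h

theorem trace_parWEven (m : ℕ) (u : K) : (parWEven m u).1.trace = 2 + u ^ 2 * gS m u ^ 2 := by
  have h := fS_gS u m
  rw [parWEven_coe, Matrix.trace_fin_two]
  simp
  linear_combination h

theorem trace_parWOdd (m : ℕ) (u : K) : (parWOdd m u).1.trace = 2 - u * fS m u ^ 2 := by
  rw [parWOdd_coe, Matrix.trace_fin_two]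
  simp
  ring

/-- The value of `S_{N-1}` at the trace of `w`. -/
def sigma (w : SL(2, K)) (N : ℕ) : K := (Polynomial.Chebyshev.S K ((N : ℤ) - 1)).eval w.1.trace

/-- The value of `S_{N-2}` at the trace of `w`. -/
def tau (w : SL(2, K)) (N : ℕ) : K := (Polynomial.Chebyshev.S K ((N : ℤ) - 2)).eval w.1.trace

/-- The power is w^N = σw - τ, so the hypothesis is the vanishing of its upper left entry. A matrix
[[0, q], [-uq, s]] is what intertwines `parA` and `parB u`, and its determinant gives uq² = 1. -/
theorem pow_coe_of_root {u : K} {w : SL(2, K)} {N : ℕ} (hw : w 1 0 = -u * w 0 1)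
    (hroot : sigma w N * w 0 0 - tau w N = 0) :
    (w ^ N).1 = !![0, sigma w N * w 0 1; -u * (sigma w N * w 0 1),
      w.1.trace * sigma w N - 2 * tau w N] := by
  have h := pow_eq_chebyshev w.1 w.2 N
  rw [Matrix.SpecialLinearGroup.coe_pow, h, ← sigma, ← tau, Matrix.trace_fin_two]
  ext i j
  fin_cases i <;> fin_cases j <;> simp [hw]
  · exact hroot
  · ring
  · linear_combination -hroot

theorem mul_sq_of_root {u : K} {w : SL(2, K)} {N : ℕ} (hw : w 1 0 = -u * w 0 1)
    (hroot : sigma w N * w 0 0 - tau w N = 0) : u * (sigma w N * w 0 1) ^ 2 = 1 := by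
  have h := (w ^ N).2
  rw [pow_coe_of_root hw hroot, Matrix.det_fin_two] at h
  simp at h
  linear_combination h

theorem relation_of_root {u : K} {w : SL(2, K)} {N : ℕ} (hw : w 1 0 = -u * w 0 1)
    (hroot : sigma w N * w 0 0 - tau w N = 0) : w ^ N * parA K = parB u * w ^ N := by
  apply Subtype.ext
  rw [Matrix.SpecialLinearGroup.coe_mul, Matrix.SpecialLinearGroup.coe_mul,
    pow_coe_of_root hw hroot, parA_coe, parB_coe]
  ext i j
  fin_cases i <;> fin_cases j <;> simp [Matrix.mul_apply, Fin.sum_univ_two]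

theorem parA_inv_pow (e : ℕ) : ((parA K)⁻¹ ^ e : SL(2, K)).1 = !![1, -(e : K); 0, 1] := by
  induction e with
  | zero => simp [Matrix.one_fin_two]
  | succ e ih =>
    rw [pow_succ, Matrix.SpecialLinearGroup.coe_mul, ih, inv_coe, parA_coe]
    ext i j
    fin_cases i <;> fin_cases j <;> simp [Matrix.mul_apply, Fin.sum_univ_two]

theorem rev_mul_of_root {u : K} {w : SL(2, K)} {N : ℕ} (hw : w 1 0 = -u * w 0 1)
    (hroot : sigma w N * w 0 0 - tau w N = 0) (e : ℕ) :
    (rev (w ^ N) * w ^ N * (parA K)⁻¹ ^ e).1 =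
      !![-1, (e : K) + 2 * (sigma w N * w 0 1) * (w.1.trace * sigma w N - 2 * tau w N); 0, -1] := by
  have h := mul_sq_of_root hw hroot
  rw [Matrix.SpecialLinearGroup.coe_mul, Matrix.SpecialLinearGroup.coe_mul, rev_coe,
    pow_coe_of_root hw hroot, parA_inv_pow]
  ext i j
  fin_cases i <;> fin_cases j <;> simp [Matrix.mul_apply, Fin.sum_univ_two]
  · linear_combination h
  · linear_combination (e : K) * h
  · linear_combination h

theorem pow_ne_one_of_coe [CharZero K] {V : SL(2, K)} {κ : K} (hV : V.1 = !![-1, κ; 0, -1])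
    (hκ : κ ≠ 0) {j : ℕ} (hj : j ≠ 0) : V ^ j ≠ 1 := by
  intro h
  have hpow : ∀ j : ℕ, (V ^ j).1 = !![(-1) ^ j, -((-1) ^ j * j * κ); 0, (-1) ^ j] := by
    intro j
    induction j with
    | zero => simp [Matrix.one_fin_two]
    | succ j ih =>
      rw [pow_succ, Matrix.SpecialLinearGroup.coe_mul, ih, hV]
      ext i j
      fin_cases i <;> fin_cases j <;> simp [Matrix.mul_apply, Fin.sum_univ_two, pow_succ]
      ring
  have h1 := hpow j
  rw [h] at h1
  have h2 := congrFun (congrFun h1 0) 1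
  simp [hj, hκ] at h2

end Standard

theorem norm_eq_one_of_mul_sq {K : Type*} [NormedField K] {u q : K} (hu : ‖u‖ ≤ 1)
    (hq : ‖q‖ ≤ 1) (h : u * q ^ 2 = 1) : ‖u‖ = 1 ∧ ‖q‖ = 1 := by
  have h1 : ‖u‖ * ‖q‖ ^ 2 = 1 := by rw [← norm_pow, ← norm_mul, h, norm_one]
  have h2 := norm_nonneg u
  have h3 := norm_nonneg q
  have h4 : ‖q‖ ^ 2 ≤ 1 := pow_le_one₀ h3 hq
  have h5 : ‖u‖ = 1 := by nlinarith
  rw [h5, one_mul] at h1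
  exact ⟨h5, (pow_eq_one_iff_of_nonneg h3 two_ne_zero).1 h1⟩

theorem norm_eq_one_of_mul {K : Type*} [NormedField K] {x y : K} (hx : ‖x‖ ≤ 1) (hy : ‖y‖ ≤ 1)
    (h : ‖x * y‖ = 1) : ‖x‖ = 1 ∧ ‖y‖ = 1 := by
  rw [norm_mul] at h
  have h2 := norm_nonneg x
  have h3 := norm_nonneg y
  constructor <;> nlinarith

section Ultrametric

variable {K : Type*} [NormedField K] [IsUltrametricDist K]

theorem norm_two_add_le (h2 : ‖(2 : K)‖ < 1) {u : K} (hu : ‖u‖ ≤ 1) : ‖2 + u‖ ≤ 1 :=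
  (IsUltrametricDist.norm_add_le_max _ _).trans (max_le h2.le hu)

theorem norm_gS_le (h2 : ‖(2 : K)‖ < 1) {u : K} (hu : ‖u‖ ≤ 1) (m : ℕ) : ‖gS m u‖ ≤ 1 :=
  (norm_S_le_one (norm_two_add_le h2 hu) m).1

theorem norm_fS_le (h2 : ‖(2 : K)‖ < 1) {u : K} (hu : ‖u‖ ≤ 1) (m : ℕ) : ‖fS m u‖ ≤ 1 := by
  rw [fS, sub_eq_add_neg]
  refine (IsUltrametricDist.norm_add_le_max _ _).trans (max_le
    (norm_S_le_one (norm_two_add_le h2 hu) m).2 ?_)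
  rw [norm_neg]
  exact norm_gS_le h2 hu m

theorem norm_sigma_le {w : SL(2, K)} (hw : ‖w.1.trace‖ ≤ 1) (N : ℕ) : ‖sigma w N‖ ≤ 1 :=
  (norm_S_le_one hw N).1

theorem norm_tau_le {w : SL(2, K)} (hw : ‖w.1.trace‖ ≤ 1) {N : ℕ} (hN : 1 ≤ N) :
    ‖tau w N‖ ≤ 1 := by
  obtain ⟨M, rfl⟩ : ∃ M, N = M + 1 := ⟨N - 1, by omega⟩
  rw [tau]
  push_cast
  rw [show (M : ℤ) + 1 - 2 = M - 1 by ring]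
  exact (norm_S_le_one hw M).1

/-- Write q = σ w₀₁ and s = zσ - 2τ. All quantities are integral and uq² = 1, so u, q, σ and w₀₁ =
-u g² are units. Modulo the maximal ideal, which contains 2, the trace z is u²g², hence a unit, and
so is s. Thus 2qs ≠ 0 in characteristic zero. -/
theorem shear_even_ne_zero [CharZero K] (h2 : ‖(2 : K)‖ < 1) {m N : ℕ} (hN : 1 ≤ N) {u : K}
    (hu : ‖u‖ ≤ 1)
    (hroot : sigma (parWEven m u) N * (parWEven m u) 0 0 - tau (parWEven m u) N = 0) :
    2 * (sigma (parWEven m u) N * (parWEven m u) 0 1) *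
      ((parWEven m u).1.trace * sigma (parWEven m u) N - 2 * tau (parWEven m u) N) ≠ 0 := by
  set w := parWEven m u with hw
  have h01 : w 0 1 = -(u * gS m u ^ 2) := by rw [hw, parWEven_coe]; rfl
  have h10 : w 1 0 = -u * w 0 1 := by rw [h01, hw, parWEven_coe]; rfl
  have hz : w.1.trace = 2 + u ^ 2 * gS m u ^ 2 := trace_parWEven m u
  have hg := norm_gS_le h2 hu m
  have hug : ‖u ^ 2 * gS m u ^ 2‖ ≤ 1 := by
    rw [norm_mul, norm_pow, norm_pow]
    exact mul_le_one₀ (pow_le_one₀ (norm_nonneg _) hu) (by positivity)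
      (pow_le_one₀ (norm_nonneg _) hg)
  have hz1 : ‖w.1.trace‖ ≤ 1 := by rw [hz]; exact norm_two_add_le h2 hug
  have hσ := norm_sigma_le hz1 N
  have hw1 : ‖w 0 1‖ ≤ 1 := by
    rw [h01, norm_neg, norm_mul, norm_pow]
    exact mul_le_one₀ hu (by positivity) (pow_le_one₀ (norm_nonneg _) hg)
  have hq : ‖sigma w N * w 0 1‖ ≤ 1 := by
    rw [norm_mul]
    exact mul_le_one₀ hσ (norm_nonneg _) hw1
  obtain ⟨hu1, hq1⟩ := norm_eq_one_of_mul_sq hu hq (mul_sq_of_root h10 hroot)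
  obtain ⟨hσ1, hw01⟩ := norm_eq_one_of_mul hσ hw1 hq1
  have hug1 : ‖u ^ 2 * gS m u ^ 2‖ = 1 := by
    rw [h01, norm_neg, norm_mul, hu1, one_mul] at hw01
    rw [norm_mul, norm_pow u, hu1, hw01]
    norm_num
  have hz2 : ‖w.1.trace‖ = 1 := by
    rw [hz, add_comm, norm_add_eq_left (by rw [hug1]; exact h2), hug1]
  have hs : ‖w.1.trace * sigma w N - 2 * tau w N‖ = 1 := by
    have h3 : ‖w.1.trace * sigma w N‖ = 1 := by rw [norm_mul, hz2, hσ1, one_mul]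
    rw [norm_sub_eq_left, h3]
    rw [h3, norm_mul]
    nlinarith [norm_tau_le hz1 hN, norm_nonneg (tau w N), norm_nonneg (2 : K)]
  refine mul_ne_zero (mul_ne_zero two_ne_zero ?_) ?_
  · rw [← norm_ne_zero_iff, hq1]; exact one_ne_zero
  · rw [← norm_ne_zero_iff, hs]; exact one_ne_zero

/-- As in the even case q and s are units. Half of the entry is qs + 2N, a unit plus a nonunit, so
the correction 4N cannot cancel it. -/
theorem shear_odd_ne_zero [CharZero K] (h2 : ‖(2 : K)‖ < 1) {m N : ℕ} (hN : 1 ≤ N) {u : K}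
    (hu : ‖u‖ ≤ 1)
    (hroot : sigma (parWOdd m u) N * (parWOdd m u) 0 0 - tau (parWOdd m u) N = 0) :
    ((4 * N : ℕ) : K) + 2 * (sigma (parWOdd m u) N * (parWOdd m u) 0 1) *
      ((parWOdd m u).1.trace * sigma (parWOdd m u) N - 2 * tau (parWOdd m u) N) ≠ 0 := by
  set w := parWOdd m u with hw
  have h01 : w 0 1 = fS m u ^ 2 := by rw [hw, parWOdd_coe]; rfl
  have h10 : w 1 0 = -u * w 0 1 := by rw [h01, hw, parWOdd_coe]; rfl
  have hz : w.1.trace = 2 - u * fS m u ^ 2 := trace_parWOdd m u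
  have hf := norm_fS_le h2 hu m
  have hw1 : ‖w 0 1‖ ≤ 1 := by
    rw [h01, norm_pow]
    exact pow_le_one₀ (norm_nonneg _) hf
  have hz1 : ‖w.1.trace‖ ≤ 1 := by
    rw [hz, ← h01, sub_eq_add_neg]
    refine norm_two_add_le h2 ?_
    rw [norm_neg, norm_mul]
    exact mul_le_one₀ hu (norm_nonneg _) hw1
  have hσ := norm_sigma_le hz1 N
  have hq : ‖sigma w N * w 0 1‖ ≤ 1 := by
    rw [norm_mul]
    exact mul_le_one₀ hσ (norm_nonneg _) hw1
  obtain ⟨hu1, hq1⟩ := norm_eq_one_of_mul_sq hu hq (mul_sq_of_root h10 hroot)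
  obtain ⟨hσ1, hw01⟩ := norm_eq_one_of_mul hσ hw1 hq1
  have hz2 : ‖w.1.trace‖ = 1 := by
    have h3 : ‖u * w 0 1‖ = 1 := by rw [norm_mul, hu1, hw01, one_mul]
    rw [hz, ← h01, ← norm_neg, neg_sub, norm_sub_eq_left (by rw [h3]; exact h2), h3]
  have hs : ‖w.1.trace * sigma w N - 2 * tau w N‖ = 1 := by
    have h3 : ‖w.1.trace * sigma w N‖ = 1 := by rw [norm_mul, hz2, hσ1, one_mul]
    rw [norm_sub_eq_left, h3]
    rw [h3, norm_mul]
    nlinarith [norm_tau_le hz1 hN, norm_nonneg (tau w N), norm_nonneg (2 : K)]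
  intro h
  have h3 : sigma w N * w 0 1 * (w.1.trace * sigma w N - 2 * tau w N) = -(2 * (N : K)) := by
    push_cast at h
    have h4 : (2 : K) ≠ 0 := two_ne_zero
    apply mul_left_cancel₀ h4
    linear_combination h
  have h4 := congrArg norm h3
  rw [norm_mul, hq1, hs, norm_neg, norm_mul, one_mul] at h4
  have h5 : ‖(N : K)‖ ≤ 1 := IsUltrametricDist.norm_natCast_le_one K N
  nlinarith [norm_nonneg (N : K), norm_nonneg (2 : K)]

/-! ### Integral solutions of the Riley equation. -/

theorem norm_two_add (h2 : ‖(2 : K)‖ < 1) {u : K} (hu : 1 < ‖u‖) : 1 < ‖2 + u‖ := by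
  rw [add_comm, norm_add_eq_left (h2.trans hu)]
  exact hu

/-- For large u the value g = S_{m-1}(2 + u) has norm at least 1 and f - ug has the same norm as g.
So the trace is dominated by (ug)² and the upper left entry by ug(f - ug). -/
theorem exists_root_even [IsAlgClosed K] [CharZero K] (h2 : ‖(2 : K)‖ < 1)
    {m N : ℕ} (hm : 1 ≤ m) (hN : 1 ≤ N) :
    ∃ u : K, ‖u‖ ≤ 1 ∧
      sigma (parWEven m u) N * (parWEven m u) 0 0 - tau (parWEven m u) N = 0 := by
  open Polynomial in
  let G : K[X] := (Chebyshev.S K ((m : ℤ) - 1)).comp (2 + X)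
  let F : K[X] := (Chebyshev.S K (m : ℤ)).comp (2 + X) - G
  have hG : ∀ u, G.eval u = gS m u := fun u => by simp [G, gS]
  have hF : ∀ u, F.eval u = fS m u := fun u => by simp [F, fS, hG]
  have hK : ∃ t : K, 1 < ‖t‖ := ⟨2⁻¹, by
    rw [norm_inv]
    exact (one_lt_inv₀ (norm_pos_iff.2 two_ne_zero)).2 h2⟩
  have hZ : ∀ u, (2 + X ^ 2 * G ^ 2 : K[X]).eval u = (parWEven m u).1.trace := fun u => by
    rw [trace_parWEven]; simp [hG]
  have hA : ∀ u, (1 - X * G * (F - X * G) : K[X]).eval u = (parWEven m u) 0 0 := fun u => by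
    rw [parWEven_coe]; simp [hG, hF]
  obtain ⟨u, hu, h⟩ := exists_riley_root hK (Z := 2 + X ^ 2 * G ^ 2)
    (Al := 1 - X * G * (F - X * G)) hN (by simp) (by simp) (by
      intro u hu
      obtain ⟨M, rfl⟩ : ∃ M, m = M + 1 := ⟨m - 1, by omega⟩
      obtain ⟨h3, h4⟩ := norm_S_lt (norm_two_add h2 hu) M
      have hg : gS (M + 1) u = (Chebyshev.S K (M : ℤ)).eval (2 + u) := by simp [gS]
      have hh : fS (M + 1) u - u * gS (M + 1) u = gS (M + 1) u -
          (Chebyshev.S K ((M : ℤ) - 1)).eval (2 + u) := by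
        have := S_sub_two_eval (M + 1) u
        push_cast at this
        rw [show (M : ℤ) + 1 - 2 = M - 1 by ring] at this
        rw [this]; ring
      have hfg : ‖fS (M + 1) u - u * gS (M + 1) u‖ = ‖gS (M + 1) u‖ := by
        rw [hh, hg, norm_sub_eq_left h3]
      rw [← hg] at h4
      have hug : 1 < ‖u * gS (M + 1) u‖ := by
        rw [norm_mul]; exact one_lt_mul_of_lt_of_le hu h4
      refine ⟨?_, Or.inl ?_⟩
      · rw [hZ, trace_parWEven, add_comm, ← mul_pow]
        have : 1 < ‖(u * gS (M + 1) u) ^ 2‖ := by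
          rw [norm_pow]; exact one_lt_pow₀ hug two_ne_zero
        rwa [norm_add_eq_left (h2.trans this)]
      · rw [hA, parWEven_coe]
        have : 1 < ‖u * gS (M + 1) u * (fS (M + 1) u - u * gS (M + 1) u)‖ := by
          rw [norm_mul, hfg]; exact one_lt_mul_of_lt_of_le hug h4
        change 1 < ‖1 - u * gS (M + 1) u * (fS (M + 1) u - u * gS (M + 1) u)‖
        rwa [← norm_neg, neg_sub, norm_sub_eq_left (by rwa [norm_one])])
  rw [hZ, hA] at h
  exact ⟨u, hu, h⟩

theorem exists_root_odd [IsAlgClosed K] [CharZero K] (h2 : ‖(2 : K)‖ < 1) {m N : ℕ} (hN : 1 ≤ N)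
    (hmN : 1 ≤ m ∨ 2 ≤ N) :
    ∃ u : K, ‖u‖ ≤ 1 ∧
      sigma (parWOdd m u) N * (parWOdd m u) 0 0 - tau (parWOdd m u) N = 0 := by
  open Polynomial in
  let G : K[X] := (Chebyshev.S K ((m : ℤ) - 1)).comp (2 + X)
  let F : K[X] := (Chebyshev.S K (m : ℤ)).comp (2 + X) - G
  have hG : ∀ u, G.eval u = gS m u := fun u => by simp [G, gS]
  have hF : ∀ u, F.eval u = fS m u := fun u => by simp [F, fS, hG]
  have hK : ∃ t : K, 1 < ‖t‖ := ⟨2⁻¹, by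
    rw [norm_inv]
    exact (one_lt_inv₀ (norm_pos_iff.2 two_ne_zero)).2 h2⟩
  have hZ : ∀ u, (2 - X * F ^ 2 : K[X]).eval u = (parWOdd m u).1.trace := fun u => by
    rw [trace_parWOdd]; simp [hF]
  have hA : ∀ u, (1 + X * F * G : K[X]).eval u = (parWOdd m u) 0 0 := fun u => by
    rw [parWOdd_coe]; simp [hG, hF]
  obtain ⟨u, hu, h⟩ := exists_riley_root hK (Z := 2 - X * F ^ 2)
    (Al := 1 + X * F * G) hN (by simp) (by simp) (by
      intro u hu
      obtain ⟨h3, h4⟩ := norm_S_lt (norm_two_add h2 hu) m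
      have hf : ‖fS m u‖ = ‖(Chebyshev.S K (m : ℤ)).eval (2 + u)‖ := norm_sub_eq_left h3
      rw [← hf] at h4
      have huf : 1 < ‖u * fS m u‖ := by
        rw [norm_mul]; exact one_lt_mul_of_lt_of_le hu h4
      constructor
      · rw [hZ, trace_parWOdd]
        have : 1 < ‖u * fS m u ^ 2‖ := by
          rw [sq, ← mul_assoc, norm_mul]; exact one_lt_mul_of_lt_of_le huf h4
        rwa [← norm_neg, neg_sub, norm_sub_eq_left (h2.trans this)]
      · rw [hA, parWOdd_coe]
        change 1 < ‖1 + u * fS m u * gS m u‖ ∨ 1 + u * fS m u * gS m u = 1 ∧ 2 ≤ N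
        rcases Nat.eq_zero_or_pos m with rfl | hm
        · right
          refine ⟨by simp [gS], by omega⟩
        · left
          obtain ⟨M, rfl⟩ : ∃ M, m = M + 1 := ⟨m - 1, by omega⟩
          have hg : gS (M + 1) u = (Chebyshev.S K (M : ℤ)).eval (2 + u) := by simp [gS]
          have h5 := (norm_S_lt (norm_two_add h2 hu) M).2
          rw [← hg] at h5
          have : 1 < ‖u * fS (M + 1) u * gS (M + 1) u‖ := by
            rw [norm_mul]; exact one_lt_mul_of_lt_of_le huf h5
          rwa [add_comm, norm_add_eq_left (by rwa [norm_one])])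
  rw [hZ, hA] at h
  exact ⟨u, hu, h⟩

end Ultrametric

/-! ### Elements of infinite order commuting with the meridian -/

theorem exists_hom {H : Type*} [Group H] {k N : ℕ} {A B : H}
    (h : FreeGroup.lift ![A, B] (word k) ^ N * A = B * FreeGroup.lift ![A, B] (word k) ^ N) :
    ∃ σ : KnotGroup k (N : ℤ) →* H, ∀ g, σ (proj k N g) = FreeGroup.lift ![A, B] g := by
  have hr : ∀ r ∈ ({relator k N} : Set F2), FreeGroup.lift ![A, B] r = 1 := by
    intro r hr
    have ha : FreeGroup.lift ![A, B] fa = A := by simp [fa]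
    have hb : FreeGroup.lift ![A, B] fb = B := by simp [fb]
    rw [Set.mem_singleton_iff.1 hr, relator, zpow_neg, zpow_natCast, map_mul, map_mul, map_mul,
      map_inv, map_inv, map_pow, ha, hb, h]
    group
  refine ⟨PresentedGroup.toGroup hr, fun g => ?_⟩
  have : (PresentedGroup.toGroup hr).comp (proj k N) = FreeGroup.lift ![A, B] := by
    ext i
    change PresentedGroup.toGroup hr (PresentedGroup.of i) = _
    rw [PresentedGroup.toGroup.of, FreeGroup.lift_apply_of]
  exact DFunLike.congr_fun this g

theorem proj_rel (k N : ℕ) :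
    proj k N (word k) ^ N * proj k N fa = proj k N fb * proj k N (word k) ^ N := by
  have h := proj_conj (k := k) (n := N)
  simp only [zpow_natCast, map_mul, map_inv, map_pow] at h
  rw [← h, inv_mul_cancel_right]

theorem norm_two_lt_one : ‖(2 : PadicAlgCl 2)‖ < 1 := by
  have h := PadicAlgCl.norm_extends 2 (2 : ℚ_[2])
  rw [map_ofNat] at h
  rw [h]
  exact_mod_cast Padic.norm_p_lt_one (p := 2)

theorem exists_commuting_even (m N : ℕ) (hm : 1 ≤ m) (hN : 1 ≤ N) :
    ∃ l : KnotGroup (2 * m) (N : ℤ), Commute l (proj _ _ fa) ∧ abel _ _ l = 1 ∧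
      ∀ j : ℕ, j ≠ 0 → l ^ j ≠ 1 := by
  have hw : proj (2 * m) (N : ℤ) (word (2 * m)) =
      (proj _ _ fb * (proj _ _ fa)⁻¹) ^ m * ((proj _ _ fb)⁻¹ * proj _ _ fa) ^ m := by
    rw [word_even]
    simp only [map_mul, map_inv, map_pow]
  refine ⟨_, reverse_even _ _ m N hw (proj_rel _ _), ?_, fun j hj h => ?_⟩
  · simp only [map_mul, map_inv, map_pow, abel_fa, abel_fb, mul_inv_cancel, one_pow, inv_one,
      one_mul, mul_one, inv_mul_cancel]
  obtain ⟨u, hu, hroot⟩ := exists_root_even norm_two_lt_one hm hN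
  have h10 : (parWEven m u) 1 0 = -u * (parWEven m u) 0 1 := by rw [parWEven_coe]; rfl
  have hlift : FreeGroup.lift ![parA _, parB u] (word (2 * m)) = parWEven m u := by
    rw [word_even, parWEven]
    simp only [map_mul, map_inv, map_pow, fa, fb, FreeGroup.lift_apply_of]
    rfl
  obtain ⟨σ, hσ⟩ := exists_hom (k := 2 * m) (N := N) (A := parA _) (B := parB u)
    (by rw [hlift]; exact relation_of_root h10 hroot)
  have ha : σ (proj _ _ fa) = parA _ := by rw [hσ, fa, FreeGroup.lift_apply_of]; rfl
  have hb : σ (proj _ _ fb) = parB u := by rw [hσ, fb, FreeGroup.lift_apply_of]; rfl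
  have h1 := congrArg σ h
  simp only [map_mul, map_inv, map_pow, map_one, ha, hb] at h1
  rw [hσ, hlift] at h1
  have hrev : rev (parWEven m u ^ N) =
      ((parB u * (parA (PadicAlgCl 2))⁻¹) ^ m)⁻¹ * (parWEven m u ^ N)⁻¹ *
        (parB u * (parA (PadicAlgCl 2))⁻¹) ^ m := by
    rw [rev_pow, rev_word_even (w := parWEven m u) rev_parA (rev_parB u) m rfl]
    have := conj_pow (i := N) (a := ((parB u * (parA (PadicAlgCl 2))⁻¹) ^ m)⁻¹)
      (b := (parWEven m u)⁻¹)
    rw [inv_inv] at this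
    rw [this, inv_pow]
  rw [← hrev] at h1
  have h2 := rev_mul_of_root h10 hroot 0
  rw [pow_zero, mul_one, Nat.cast_zero, zero_add] at h2
  exact pow_ne_one_of_coe h2 (shear_even_ne_zero norm_two_lt_one hN hu hroot) hj h1

/-- Both wⁿ and its reversed word have exponent sum 2n, so a⁻⁴ⁿ is appended to make the
abelianization trivial. Infinite order is tested in the 2-adic representation attached to an
integral Riley root. -/
theorem exists_commuting_odd (m N : ℕ) (hN : 1 ≤ N) (hmN : 1 ≤ m ∨ 2 ≤ N) :
    ∃ l : KnotGroup (2 * m + 1) (N : ℤ), Commute l (proj _ _ fa) ∧ abel _ _ l = 1 ∧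
      ∀ j : ℕ, j ≠ 0 → l ^ j ≠ 1 := by
  have hw : proj (2 * m + 1) (N : ℤ) (word (2 * m + 1)) =
      (proj _ _ fb * (proj _ _ fa)⁻¹) ^ m * (proj _ _ fb * proj _ _ fa) *
        ((proj _ _ fb)⁻¹ * proj _ _ fa) ^ m := by
    rw [word_odd]
    simp only [map_mul, map_inv, map_pow]
  refine ⟨_, (reverse_odd _ _ m N hw (proj_rel _ _)).mul_left
    ((Commute.refl (proj _ _ fa)).inv_left.pow_left (4 * N)), ?_, fun j hj h => ?_⟩
  · rw [hw]
    simp only [map_mul, map_inv, map_pow, abel_fa, abel_fb, mul_inv_cancel, one_pow, inv_one,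
      one_mul, mul_one, inv_mul_cancel]
    generalize Multiplicative.ofAdd (1 : ℤ) = t
    rw [mul_comm t, mul_inv_cancel_right, inv_pow, mul_inv_eq_one, ← sq, ← pow_mul, ← sq, ← pow_mul]
    congr 1
    ring
  obtain ⟨u, hu, hroot⟩ := exists_root_odd norm_two_lt_one hN hmN
  have h10 : (parWOdd m u) 1 0 = -u * (parWOdd m u) 0 1 := by rw [parWOdd_coe]; rfl
  have hlift : FreeGroup.lift ![parA _, parB u] (word (2 * m + 1)) = parWOdd m u := by
    rw [word_odd, parWOdd]
    simp only [map_mul, map_inv, map_pow, fa, fb, FreeGroup.lift_apply_of]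
    rfl
  obtain ⟨σ, hσ⟩ := exists_hom (k := 2 * m + 1) (N := N) (A := parA _) (B := parB u)
    (by rw [hlift]; exact relation_of_root h10 hroot)
  have ha : σ (proj _ _ fa) = parA _ := by rw [hσ, fa, FreeGroup.lift_apply_of]; rfl
  have hb : σ (proj _ _ fb) = parB u := by rw [hσ, fb, FreeGroup.lift_apply_of]; rfl
  have h1 := congrArg σ h
  simp only [map_mul, map_inv, map_pow, map_one, ha, hb] at h1
  rw [hσ, hlift] at h1
  have hrev : rev (parWOdd m u ^ N) =
      ((parB u * (parA (PadicAlgCl 2))⁻¹) ^ m)⁻¹ * parA (PadicAlgCl 2) * parWOdd m u ^ N *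
        (parA (PadicAlgCl 2))⁻¹ * (parB u * (parA (PadicAlgCl 2))⁻¹) ^ m := by
    rw [rev_pow, rev_word_odd (w := parWOdd m u) rev_parA (rev_parB u) m rfl]
    have := conj_pow (i := N) (a := ((parB u * (parA (PadicAlgCl 2))⁻¹) ^ m)⁻¹ * parA _)
      (b := parWOdd m u)
    rw [mul_inv_rev, inv_inv, ← mul_assoc, ← mul_assoc] at this
    exact this
  rw [← hrev] at h1
  exact pow_ne_one_of_coe (rev_mul_of_root h10 hroot (4 * N))
    (shear_odd_ne_zero norm_two_lt_one hN hu hroot) hj h1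

/-! ### Meridians of discrete and faithful representations are parabolic -/

section Discrete

open Filter Topology

/-- A sequence in a compact annulus has a subsequence with nonzero limit, and ratios of consecutive
terms of it tend to 1. -/
theorem exists_ratio_mem (x : ℕ → ℂˣ) {r R : ℝ} (hr : 0 < r)
    (hx : ∀ k, r ≤ ‖(x k : ℂ)‖ ∧ ‖(x k : ℂ)‖ ≤ R) {V : Set ℂˣ} (hV : V ∈ 𝓝 1) :
    ∃ k l : ℕ, k < l ∧ x l * (x k)⁻¹ ∈ V := by
  obtain ⟨O, hO, hOV⟩ : ∃ O ∈ 𝓝 (1 : ℂ), Units.val ⁻¹' O ⊆ V := by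
    rw [Units.isEmbedding_val₀.nhds_eq_comap] at hV
    exact hV
  obtain ⟨y, -, φ, hφ, hlim⟩ := tendsto_subseq_of_bounded (s := Metric.closedBall (0 : ℂ) R)
    Metric.isBounded_closedBall (x := fun k => (x k : ℂ))
    (fun k => by rw [mem_closedBall_zero_iff]; exact (hx k).2)
  have hy : y ≠ 0 := by
    have h : r ≤ ‖y‖ := ge_of_tendsto hlim.norm (Eventually.of_forall fun k => (hx (φ k)).1)
    exact norm_pos_iff.1 (hr.trans_le h)
  have h1 : Tendsto (fun k => (x (φ (k + 1)) : ℂ) * ((x (φ k) : ℂ))⁻¹) atTop (𝓝 (y * y⁻¹)) :=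
    (hlim.comp (tendsto_add_atTop_nat 1)).mul (hlim.inv₀ hy)
  rw [mul_inv_cancel₀ hy] at h1
  obtain ⟨k, hk⟩ := (h1.eventually_mem hO).exists
  refine ⟨φ k, φ (k + 1), hφ (Nat.lt_succ_self k), hOV ?_⟩
  simpa using hk

/-- This says that ℂˣ contains no discrete copy of ℤ²: it is a circle times a line. -/
theorem exists_zpow_mul_zpow_mem (μ ν : ℂˣ) {V : Set ℂˣ} (hV : V ∈ 𝓝 1) :
    ∃ i j : ℤ, (i ≠ 0 ∨ j ≠ 0) ∧ μ ^ i * ν ^ j ∈ V := by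
  have hμ : 0 < ‖(μ : ℂ)‖ := norm_pos_iff.2 μ.ne_zero
  have hν : 0 < ‖(ν : ℂ)‖ := norm_pos_iff.2 ν.ne_zero
  set α := Real.log ‖(μ : ℂ)‖ with hα
  set β := Real.log ‖(ν : ℂ)‖ with hβ
  by_cases h0 : α = 0
  · have h1 : ‖(μ : ℂ)‖ = 1 := Real.eq_one_of_pos_of_log_eq_zero hμ h0
    obtain ⟨k, l, hkl, h⟩ := exists_ratio_mem (fun k => μ ^ k) one_pos (R := 1)
      (fun k => by simp [h1]) hV
    refine ⟨(l : ℤ) - k, 0, Or.inl (by omega), ?_⟩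
    rwa [zpow_zero, mul_one, zpow_sub, zpow_natCast, zpow_natCast]
  -- The exponent of μ is chosen so that log ‖μ^i ν^k‖ stays within |α|; all these products then lie
  -- in one annulus.
  · let i : ℕ → ℤ := fun k => -⌊k * β / α⌋
    have hb : ∀ k : ℕ, |i k * α + k * β| ≤ |α| := by
      intro k
      have h1 : (i k : ℝ) * α + k * β = Int.fract (k * β / α) * α := by
        simp only [i, Int.fract]
        push_cast
        field_simp
        ring
      rw [h1, abs_mul, abs_of_nonneg (Int.fract_nonneg _)]
      exact mul_le_of_le_one_left (abs_nonneg _) (Int.fract_lt_one _).le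
    have hnorm : ∀ k : ℕ, ‖((μ ^ i k * ν ^ k : ℂˣ) : ℂ)‖ = Real.exp (i k * α + k * β) := by
      intro k
      rw [Units.val_mul, norm_mul, Units.val_zpow_eq_zpow_val, norm_zpow, Units.val_pow_eq_pow_val,
        norm_pow, Real.exp_add, mul_comm (i k : ℝ), Real.exp_mul, Real.rpow_intCast,
        Real.exp_nat_mul, hα, hβ, Real.exp_log hμ,
        Real.exp_log hν]
    obtain ⟨k, l, hkl, h⟩ := exists_ratio_mem (fun k => μ ^ i k * ν ^ k)
      (Real.exp_pos (-|α|)) (R := Real.exp |α|)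
      (fun k => by
        rw [hnorm, Real.exp_le_exp, Real.exp_le_exp]
        exact abs_le.1 (hb k)) hV
    refine ⟨i l - i k, (l : ℤ) - k, Or.inr (by omega), ?_⟩
    rw [zpow_sub, zpow_sub, zpow_natCast, zpow_natCast]
    convert h using 1
    rw [mul_inv]
    exact mul_mul_mul_comm _ _ _ _

/-- Diagonal matrices in `SL₂(ℂ)`. -/
def diagSL : ℂˣ →* SL(2, ℂ) where
  toFun x := ⟨!![(x : ℂ), 0; 0, ((x⁻¹ : ℂˣ) : ℂ)], by simp [Matrix.det_fin_two]⟩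
  map_one' := by
    apply Subtype.ext
    simp [Matrix.one_fin_two]
  map_mul' x y := by
    apply Subtype.ext
    change !![((x * y : ℂˣ) : ℂ), 0; 0, (((x * y)⁻¹ : ℂˣ) : ℂ)] =
      !![(x : ℂ), 0; 0, ((x⁻¹ : ℂˣ) : ℂ)] * !![(y : ℂ), 0; 0, ((y⁻¹ : ℂˣ) : ℂ)]
    ext i j
    fin_cases i <;> fin_cases j <;> simp [Matrix.mul_apply, Fin.sum_univ_two, mul_comm]

theorem diagSL_coe (x : ℂˣ) : (diagSL x).1 = !![(x : ℂ), 0; 0, ((x⁻¹ : ℂˣ) : ℂ)] := rfl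

theorem continuous_diagSL : Continuous diagSL := by
  refine Continuous.subtype_mk ?_ _
  refine continuous_matrix fun i j => ?_
  fin_cases i <;> fin_cases j
  · exact Units.continuous_val
  · exact continuous_const
  · exact continuous_const
  · exact Units.continuous_val.comp continuous_inv

theorem exists_diagSL {V : SL(2, ℂ)} (h01 : V 0 1 = 0) (h10 : V 1 0 = 0) :
    ∃ x : ℂˣ, V = diagSL x := by
  have hdet := sl2_det V
  rw [h01, zero_mul, sub_zero] at hdet
  refine ⟨Units.mk0 (V 0 0) (left_ne_zero_of_mul_eq_one hdet), Subtype.ext ?_⟩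
  rw [diagSL_coe]
  have h11 := eq_inv_of_mul_eq_one_right hdet
  ext i j
  fin_cases i <;> fin_cases j
  · rfl
  · exact h01
  · exact h10
  · simpa using h11

theorem exists_diagonal {V : SL(2, ℂ)} (hV : V.1.trace ^ 2 ≠ 4) :
    ∃ (P : SL(2, ℂ)) (x : ℂˣ), V = P * diagSL x * P⁻¹ ∧ (x : ℂ) ≠ ((x⁻¹ : ℂˣ) : ℂ) := by
  obtain ⟨P, T, rfl, hT⟩ := exists_triangular V
  have htr : (P * T * P⁻¹).1.trace = T 0 0 + T 1 1 := by
    rw [Matrix.SpecialLinearGroup.coe_mul, Matrix.trace_mul_comm,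
      ← Matrix.SpecialLinearGroup.coe_mul, inv_mul_cancel_left, Matrix.trace_fin_two]
  have hdet := sl2_det T
  rw [hT, mul_zero, sub_zero] at hdet
  have hne : T 0 0 - T 1 1 ≠ 0 := by
    intro h
    apply hV
    rw [htr]
    linear_combination (T 0 0 - T 1 1) * h + 4 * hdet
  -- The shear that removes the upper right entry of T; it exists because the two eigenvalues
  -- differ.
  let U : SL(2, ℂ) := ⟨!![1, -(T 0 1 / (T 0 0 - T 1 1)); 0, 1], by simp [Matrix.det_fin_two]⟩
  have hU : U.1 = !![1, -(T 0 1 / (T 0 0 - T 1 1)); 0, 1] := rfl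
  have hUT : (U⁻¹ * T * U).1 = !![T 0 0, 0; 0, T 1 1] := by
    rw [Matrix.SpecialLinearGroup.coe_mul, Matrix.SpecialLinearGroup.coe_mul, inv_coe, hU]
    ext i j
    simp only [Matrix.mul_apply, Fin.sum_univ_two]
    fin_cases i <;> fin_cases j <;> simp [hT]
    field_simp
    ring
  obtain ⟨x, hx⟩ := exists_diagSL (V := U⁻¹ * T * U) (by rw [hUT]; rfl) (by rw [hUT]; rfl)
  refine ⟨P * U, x, ?_, ?_⟩
  · rw [← hx]; group
  · rw [hx, diagSL_coe] at hUT
    have h1 : (x : ℂ) = T 0 0 := congrFun (congrFun hUT 0) 0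
    have h2 : ((x⁻¹ : ℂˣ) : ℂ) = T 1 1 := congrFun (congrFun hUT 1) 1
    rw [h1, h2]
    exact sub_ne_zero.1 hne

theorem exists_diagSL_of_commute {x : ℂˣ} (hx : (x : ℂ) ≠ ((x⁻¹ : ℂˣ) : ℂ)) {V : SL(2, ℂ)}
    (h : Commute V (diagSL x)) : ∃ y : ℂˣ, V = diagSL y := by
  have h1 := congrArg Subtype.val h.eq
  rw [Matrix.SpecialLinearGroup.coe_mul, Matrix.SpecialLinearGroup.coe_mul, diagSL_coe] at h1
  have h01 := congrFun (congrFun h1 0) 1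
  have h10 := congrFun (congrFun h1 1) 0
  simp only [Matrix.mul_apply, Fin.sum_univ_two, Matrix.of_apply, Matrix.cons_val',
    Matrix.cons_val_zero, Matrix.cons_val_one, Matrix.cons_val_fin_one, mul_zero, zero_mul,
    zero_add, add_zero] at h01 h10
  refine exists_diagSL ?_ ?_
  · have : V 0 1 * (((x⁻¹ : ℂˣ) : ℂ) - x) = 0 := by linear_combination h01
    exact (mul_eq_zero.1 this).resolve_right (sub_ne_zero.2 hx.symm)
  · have : V 1 0 * ((x : ℂ) - ((x⁻¹ : ℂˣ) : ℂ)) = 0 := by linear_combination h10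
    exact (mul_eq_zero.1 this).resolve_right (sub_ne_zero.2 hx)

theorem IsHolonomyLift.exists_nhds {G : Type} [Group G] {ρ : G →* SL(2, ℂ)}
    (h : IsHolonomyLift ρ) : ∃ U ∈ 𝓝 (1 : SL(2, ℂ)), ∀ g, ρ g ∈ U → g = 1 := by
  obtain ⟨hinj, hdisc⟩ := h
  obtain ⟨O, hO, hO1⟩ := isOpen_induced_iff.1
    (isOpen_discrete ({1} : Set (toPSL.comp ρ).range))
  have hcont : Continuous toPSL := continuous_quotient_mk'
  refine ⟨toPSL ⁻¹' O, (hO.preimage hcont).mem_nhds ?_, fun g hg => ?_⟩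
  · have : (1 : (toPSL.comp ρ).range) ∈ Subtype.val ⁻¹' O := by rw [hO1]; rfl
    rw [Set.mem_preimage, map_one]
    exact this
  · have : (⟨toPSL (ρ g), ⟨g, rfl⟩⟩ : (toPSL.comp ρ).range) ∈ Subtype.val ⁻¹' O := hg
    rw [hO1, Set.mem_singleton_iff] at this
    have h1 : toPSL.comp ρ g = 1 := congrArg Subtype.val this
    exact hinj (h1.trans (map_one _).symm)

theorem IsHolonomyLift.trace_sq {G : Type} [Group G] {ρ : G →* SL(2, ℂ)} (h : IsHolonomyLift ρ)
    {a l : G} (hc : Commute l a) (d : G →* Multiplicative ℤ) (hda : d a = Multiplicative.ofAdd 1)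
    (hdl : d l = 1) (hl : ∀ j : ℕ, j ≠ 0 → l ^ j ≠ 1) : (ρ a).1.trace ^ 2 = 4 := by
  by_contra htr
  obtain ⟨U, hU, hU1⟩ := h.exists_nhds
  obtain ⟨P, μ, hμ, hne⟩ := exists_diagonal htr
  obtain ⟨ν, hν⟩ := exists_diagSL_of_commute (V := P⁻¹ * ρ l * P) hne (by
    have h1 : Commute (ρ l) (P * diagSL μ * P⁻¹) := by rw [← hμ]; exact hc.map ρ
    have h2 : diagSL μ = P⁻¹ * (P * diagSL μ * P⁻¹) * P := by group
    rw [h2]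
    have h3 := h1.map (MulAut.conj P⁻¹).toMonoidHom
    simpa using h3)
  have hν' : ρ l = P * diagSL ν * P⁻¹ := by rw [← hν]; group
  have hcont : Continuous fun x : ℂˣ => P * diagSL x * P⁻¹ :=
    (continuous_const.mul continuous_diagSL).mul continuous_const
  have hV : (fun x : ℂˣ => P * diagSL x * P⁻¹) ⁻¹' U ∈ 𝓝 1 := by
    refine hcont.continuousAt.preimage_mem_nhds ?_
    rwa [map_one, mul_one, mul_inv_cancel]
  obtain ⟨i, j, hij, hmem⟩ := exists_zpow_mul_zpow_mem μ ν hV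
  have hg : a ^ i * l ^ j = 1 := by
    apply hU1
    rw [map_mul, map_zpow, map_zpow, hμ, hν', conj_zpow, conj_zpow, conj_mul, ← map_zpow,
      ← map_zpow, ← map_mul]
    exact hmem
  -- The abelianization kills l and sends a to the generator, so it reads off i.
  have hi : i = 0 := by
    have := congrArg (fun g => Multiplicative.toAdd (d g)) hg
    simpa [hda, hdl] using this
  rw [hi, zpow_zero, one_mul] at hg
  have hj : j ≠ 0 := hij.resolve_left (not_not.2 hi)
  refine hl j.natAbs (Int.natAbs_ne_zero.2 hj) ?_
  rcases Int.natAbs_eq j with h1 | h1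
  · rw [h1, zpow_natCast] at hg
    exact hg
  · rw [h1, zpow_neg, zpow_natCast, inv_eq_one] at hg
    exact hg

end Discrete

theorem isParabolic_of_commuting {k : ℕ} {n : ℤ} {ρ : KnotGroup k n →* SL(2, ℂ)}
    (h : IsHolonomyLift ρ ∨ IsParabolic ρ)
    (hl : ∃ l : KnotGroup k n, Commute l (proj _ _ fa) ∧ abel _ _ l = 1 ∧
      ∀ j : ℕ, j ≠ 0 → l ^ j ≠ 1) : IsParabolic ρ := by
  rcases h with h | h
  · obtain ⟨l, hc, hl1, hl⟩ := hl
    have htr := h.trace_sq hc (abel k n) abel_fa hl1 hl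
    refine ⟨?_, ?_⟩
    -- If the image were abelian, so would be the group, by faithfulness. Then b = a and a generates
    -- everything, so l is a power of a with trivial abelianization, that is l = 1.
    · by_contra hab
      have hinj : Function.Injective ρ := fun x y hxy => h.1 (congrArg toPSL hxy)
      have hcomm : ∀ x y : KnotGroup k n, x * y = y * x := fun x y => by
        by_contra hxy
        exact hab ⟨x, y, fun he => hxy (hinj (by rw [map_mul, map_mul, he]))⟩
      have hba : proj k n fb = proj k n fa := by
        rw [← proj_conj, map_mul, map_mul, map_inv, hcomm (proj k n (word k ^ n)),
          mul_inv_cancel_right]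
      have hz : ∀ x : F2, proj k n x ∈ Subgroup.zpowers (proj k n fa) := by
        intro x
        induction x using FreeGroup.induction_on with
        | C1 => rw [map_one]; exact one_mem _
        | of i =>
          fin_cases i
          · exact Subgroup.mem_zpowers _
          · change proj k n fb ∈ _
            rw [hba]
            exact Subgroup.mem_zpowers _
        | inv_of i hi => rw [map_inv]; exact inv_mem hi
        | mul x y hx hy => rw [map_mul]; exact mul_mem hx hy
      obtain ⟨x, rfl⟩ := PresentedGroup.mk_surjective _ l
      obtain ⟨i, hi⟩ := hz x
      have hi : proj k n fa ^ i = proj k n x := hi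
      have h0 : i = 0 := by
        have := congrArg (fun g => Multiplicative.toAdd (abel k n g)) hi
        have h1 : abel k n (proj k n x) = 1 := hl1
        simpa [abel_fa, h1] using this
      apply hl 1 one_ne_zero
      rw [pow_one]
      change proj k n x = 1
      rw [← hi, h0, zpow_zero]
    · have : ((ρ (proj k n fa)).1.trace - 2) * ((ρ (proj k n fa)).1.trace + 2) = 0 := by
        linear_combination htr
      rcases mul_eq_zero.1 this with h | h
      · exact Or.inl (sub_eq_zero.1 h)
      · exact Or.inr (eq_neg_of_add_eq_zero_left h)
  · exact h

end DoubleTwist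

end

theorem proposition3p6 (n : ℤ) (hn : 1 ≤ n) :
    (∀ m : ℕ, 1 ≤ m → ∀ ρ : DoubleTwist.KnotGroup (2 * m) n →* Matrix.SpecialLinearGroup (Fin 2) ℂ,
      DoubleTwist.IsHolonomyLift ρ ∨ DoubleTwist.IsParabolic ρ →
      DoubleTwist.HasExtremeTerms (DoubleTwist.adjointAlexander ρ)
        0 (-((m : ℂ) * (n : ℂ) * DoubleTwist.chebS ((m : ℤ) - 1) (DoubleTwist.trY ρ) ^ 2 *
          DoubleTwist.chebS (n - 1) (DoubleTwist.trZ ρ) ^ 2))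
        (-3) ((m : ℂ) * (n : ℂ) * DoubleTwist.chebS ((m : ℤ) - 1) (DoubleTwist.trY ρ) ^ 2 *
          DoubleTwist.chebS (n - 1) (DoubleTwist.trZ ρ) ^ 2)) ∧
    (∀ m : ℕ, 1 ≤ m →
      ∀ ρ : DoubleTwist.KnotGroup (2 * m + 1) n →* Matrix.SpecialLinearGroup (Fin 2) ℂ,
      DoubleTwist.IsHolonomyLift ρ ∨ DoubleTwist.IsParabolic ρ →
      DoubleTwist.HasExtremeTerms (DoubleTwist.adjointAlexander ρ)
        (6 * n - 3) ((m : ℂ) * DoubleTwist.chebS ((m : ℤ) - 1) (DoubleTwist.trY ρ) ^ 2)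
        0 (-((m : ℂ) * DoubleTwist.chebS ((m : ℤ) - 1) (DoubleTwist.trY ρ) ^ 2))) ∧
    (2 ≤ n → ∀ ρ : DoubleTwist.KnotGroup 1 n →* Matrix.SpecialLinearGroup (Fin 2) ℂ,
      DoubleTwist.IsHolonomyLift ρ ∨ DoubleTwist.IsParabolic ρ →
      DoubleTwist.HasExtremeTerms (DoubleTwist.adjointAlexander ρ) (6 * n - 6) (-1) 3 1) := by
  obtain ⟨N, rfl⟩ := Int.eq_ofNat_of_zero_le (zero_le_one.trans hn)
  have hN : 1 ≤ N := by exact_mod_cast hn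
  refine ⟨fun m hm ρ hρ => ?_, fun m hm ρ hρ => ?_, fun hn2 ρ hρ => ?_⟩
  · have h := DoubleTwist.extremeTerms_even m N hm hN ρ
      (DoubleTwist.isParabolic_of_commuting hρ (DoubleTwist.exists_commuting_even m N hm hN))
    rwa [← Int.cast_natCast (R := ℂ) N] at h
  · exact DoubleTwist.extremeTerms_odd m N hm hN ρ
      (DoubleTwist.isParabolic_of_commuting hρ
        (DoubleTwist.exists_commuting_odd m N hN (Or.inl hm)))
  · have hN2 : 2 ≤ N := by exact_mod_cast hn2
    exact DoubleTwist.extremeTerms_one N hN2 ρ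
      (DoubleTwist.isParabolic_of_commuting hρ
        (DoubleTwist.exists_commuting_odd 0 N hN (Or.inr hN2)))
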